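/- Let $n\ge 3$. On $\mathbb R^{n+2}$, with coordinates $v=(v^0,v^1,\dots,v^{n+1})$ and standard basis $\eta_0,\dots,\eta_{n+1}$, consider the Lorentzian form $\langle v,v\rangle=\sum_{A=1}^n (v^A)^2-2v^0v^{n+1}$, and let $\mathbb Q_n\subset\mathbb P^{n+1}(\mathbb R)$ be the conformal sphere $\{[v] : \langle v,v\rangle=0\}$. Let $\mathrm{M\ddot ob}(n)$ be the identity component of the Lorentz group of this form, i.e. the group of the Lorentz matrices of determinant $1$ that preserve the positive light cone $\{\langle v,v\rangle=0,\ v^0+v^{n+1}>0\}$; it acts on $\mathbb Q_n$. For $1\le k\le n-1$, a conformal $k$-sphere in $\mathbb Q_n$ (a conformal circle if $k=1$) is the image under an element of $\mathrm{M\ddot ob}(n)$ of the standard $k$-sphere $\{[v]\in\mathbb Q_n : v^{k+1}=\dots=v^n=0\}$. Let $I\subset\mathbb R$ be a nondegenerate interval and $f:I\to\mathbb Q_n$ a smooth immersion. A (zeroth order) frame along $f$ on a relatively open $U\subset I$ is a smooth map $e=(e_0|e_1|\dots|e_{n+1}):U\to\mathrm{M\ddot ob}(n)$ with $[e_0]=f$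 on $U$; put $\phi=e^{-1}\,de$, with entries $\phi^a_b$ (row $a$, column $b$). The frame is of * first order if $\phi^\alpha_0=0$ for $2\le\alpha\le n$; * second order if moreover $\phi^\alpha_1=0$ for $2\le\alpha\le n$; then $p^\alpha$ is defined by $\phi^0_\alpha=p^\alpha\phi^1_0$; * third order if moreover $\phi^0_2=\phi^1_0$ and $\phi^0_b=0$ for $3\le b\le n$; * fourth order if moreover $\phi^0_0=0$ and $\phi^b_2=0$ for $4\le b\le n$; * $(k+1)$-th order, for $4\le k\le n-1$, if it is of $k$-th order and $\phi^b_{k-1}=0$ for $k+1\le b\le n$. A point $q\in I$ is $1$-generic if $\sum_{\alpha=2}^n(p^\alpha)^2\neq0$ at $q$ for second order frames around $q$, and $f$ is totally $1$-degenerate if $\sum_\alpha(p^\alpha)^2\equiv0$ on $I$. For $2\le k\le n-1$, a point $q$ is $k$-generic if it is $(k-1)$-generic and, for frames of order $k+1$ around $q$, $\phi^c_k\ne0$ at $q$ for at least one $c\in\{k+1,\dots,n\}$. The curve $f$ is $k$-generic if all points of $I$ are $k$-generic; it is totally $k$-degenerate ($2\le k\le n-1$) if it is $(k-1)$-generic and,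 for frames of order $k+1$, $\phi^c_k\equiv0$ on $I$ for all $c\in\{k+1,\dots,n\}$. (These conditions do not depend on the choice of the frames.) **Proposition.** The immersion $f$ is totally $1$-degenerate if and only if there is a conformal circle $\mathbb Q_1\subset\mathbb Q_n$ with $f(I)\subset\mathbb Q_1$. Moreover, for every $k\in\{2,\dots,n-1\}$, if $f$ is $(k-1)$-generic, then $f$ is totally $k$-degenerate if and only if there is a conformal $k$-sphere $\mathbb Q_k\subset\mathbb Q_n$ with $f(I)\subset\mathbb Q_k$. -/

import Mathlib

open scoped ContDiff

/-- The ambient vector space `ℝ^(n+2)`; coordinates are numbered `0, 1, …, n, n+1`. -/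
abbrev Coord (n : ℕ) : Type := Fin (n + 2) → ℝ

/-- The real projective space `ℙ^(n+1)(ℝ)`. -/
abbrev ProjSpace (n : ℕ) : Type := Projectivization ℝ (Coord n)

/-- The Lorentzian Gram matrix `S`: `S₀,ₙ₊₁ = Sₙ₊₁,₀ = -1`, the identity on the middle block. -/
def lorentzMatrix (n : ℕ) : Matrix (Fin (n + 2)) (Fin (n + 2)) ℝ :=
  Matrix.of fun i j =>
    if (i = 0 ∧ j = Fin.last (n + 1)) ∨ (i = Fin.last (n + 1) ∧ j = 0) then -1
    else if i = j ∧ i ≠ 0 ∧ i ≠ Fin.last (n + 1) then 1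
    else 0

/-- The quadratic form `ᵗv S v = ∑_A (v^A)² - 2 v⁰ vⁿ⁺¹`. -/
def lorentzForm {n : ℕ} (v : Coord n) : ℝ := v ⬝ᵥ (lorentzMatrix n).mulVec v

/-- The positive light cone `L⁺`. -/
def positiveCone (n : ℕ) : Set (Coord n) :=
  {v | lorentzForm v = 0 ∧ 0 < v 0 + v (Fin.last (n + 1))}

/-- The conformal sphere `Q_n` (Darboux hyperquadric); the condition does not depend on the
chosen representative, since the form is homogeneous. -/
def conformalSpace (n : ℕ) : Set (ProjSpace n) := {x | lorentzForm x.rep = 0}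

/-- The Möbius group `Möb(n) = SO⁺(n+1,1)`, the identity component of the Lorentz group of `S`:
the Lorentz matrices of determinant one that preserve the positive light cone. -/
def moebius (n : ℕ) : Set (Matrix (Fin (n + 2)) (Fin (n + 2)) ℝ) :=
  {G | G.transpose * lorentzMatrix n * G = lorentzMatrix n ∧ G.det = 1 ∧
    ∀ v ∈ positiveCone n, G.mulVec v ∈ positiveCone n}

/-- `v` is a vector of homogeneous coordinates of the point `x`. -/
def Represents {n : ℕ} (v : Coord n) (x : ProjSpace n) : Prop :=
  ∃ hv : v ≠ 0, Projectivization.mk ℝ v hv = x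

/-- The standard `k`-sphere `{x ∈ Q_n | x^(k+1) = … = x^n = 0}`, that is, the part of `Q_n` in the
projectivization of the span of `η_0, η_1, …, η_k, η_{n+1}`. -/
def standardSphere (n k : ℕ) : Set (ProjSpace n) :=
  {x | x ∈ conformalSpace n ∧ ∀ b : Fin (n + 2), k + 1 ≤ b.val → b.val ≤ n → x.rep b = 0}

/-- A conformal `k`-sphere in `Q_n` (a conformal circle for `k = 1`): the image of the standard
one under an element of the Möbius group. -/
def IsConformalSphere (n k : ℕ) (Q : Set (ProjSpace n)) : Prop :=
  ∃ G ∈ moebius n, Q = {x | ∃ v : Coord n, ∃ y ∈ standardSphere n k,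
    Represents v y ∧ Represents (G.mulVec v) x}

/-- `f` restricted to the interval `I` is a smooth immersion into `Q_n`: near every point of `I`
it has a smooth lift `F` to `ℝ^(n+2) ∖ {0}` with `F` and `F'` linearly independent there, which
means that the differential of `f = [F]` does not vanish. -/
def IsImmersedCurve {n : ℕ} (I : Set ℝ) (f : ℝ → ProjSpace n) : Prop :=
  (∀ t ∈ I, f t ∈ conformalSpace n) ∧
  ∀ t ∈ I, ∃ V : Set ℝ, IsOpen V ∧ t ∈ V ∧ ∃ F : ℝ → Coord n,
    ContDiffOn ℝ ∞ F (I ∩ V) ∧ (∀ s ∈ I ∩ V, Represents (F s) (f s)) ∧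
    LinearIndependent ℝ ![F t, derivWithin F I t]

/-- The pull-back `φ = e⁻¹ de` of the Maurer-Cartan form by `e`, at `t` (as a multiple of `dt`). -/
noncomputable def maurerCartan {n : ℕ} (I : Set ℝ)
    (e : ℝ → Matrix (Fin (n + 2)) (Fin (n + 2)) ℝ) (t : ℝ) :
    Matrix (Fin (n + 2)) (Fin (n + 2)) ℝ :=
  (e t)⁻¹ * Matrix.of fun i j => derivWithin (fun s => e s i j) I t

/-- The component `φ^a_b` (row `a`, column `b`), for `0 ≤ a, b ≤ n + 1`. -/
noncomputable def mcForm {n : ℕ} (I : Set ℝ)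
    (e : ℝ → Matrix (Fin (n + 2)) (Fin (n + 2)) ℝ) (t : ℝ) (a b : ℕ) : ℝ :=
  maurerCartan I e t (Fin.ofNat (n + 2) a) (Fin.ofNat (n + 2) b)

/-- `IsFrame I f m U e`: on the subset `U` of `I`, `e` is an `m`-th order frame along `f`.
* order `0`: `e` is smooth with values in `Möb(n)` and its first column represents `f`;
* order `1` (first order): `φ^α_0 = 0` for `2 ≤ α ≤ n`;
* order `2` (Darboux frames): moreover `φ^α_1 = 0` for `2 ≤ α ≤ n`;
* order `3`: moreover `φ^0_2 = φ^1_0` and `φ^0_b = 0` for `3 ≤ b ≤ n`;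
* order `4`: moreover `φ^0_0 = 0` (special third order) and `φ^b_2 = 0` for `4 ≤ b ≤ n`;
* order `k + 1`, `k ≥ 4`: moreover `φ^b_(k-1) = 0` for `k + 1 ≤ b ≤ n`. -/
def IsFrame {n : ℕ} (I : Set ℝ) (f : ℝ → ProjSpace n) :
    ℕ → Set ℝ → (ℝ → Matrix (Fin (n + 2)) (Fin (n + 2)) ℝ) → Prop
  | 0, U, e =>
      (∀ i j, ContDiffOn ℝ ∞ (fun t => e t i j) U) ∧
      ∀ t ∈ U, e t ∈ moebius n ∧ Represents (fun i => e t i 0) (f t)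
  | 1, U, e =>
      IsFrame I f 0 U e ∧ ∀ t ∈ U, ∀ a ∈ Finset.Icc 2 n, mcForm I e t a 0 = 0
  | 2, U, e =>
      IsFrame I f 1 U e ∧ ∀ t ∈ U, ∀ a ∈ Finset.Icc 2 n, mcForm I e t a 1 = 0
  | 3, U, e =>
      IsFrame I f 2 U e ∧ ∀ t ∈ U, mcForm I e t 0 2 = mcForm I e t 1 0 ∧
        ∀ b ∈ Finset.Icc 3 n, mcForm I e t 0 b = 0
  | 4, U, e =>
      IsFrame I f 3 U e ∧ ∀ t ∈ U, mcForm I e t 0 0 = 0 ∧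
        ∀ b ∈ Finset.Icc 4 n, mcForm I e t b 2 = 0
  | m + 5, U, e =>
      IsFrame I f (m + 4) U e ∧
        ∀ t ∈ U, ∀ b ∈ Finset.Icc (m + 5) n, mcForm I e t b (m + 3) = 0

/-- `e` is an `m`-th order frame along `f` on a neighbourhood of `q` in `I`. -/
def IsFrameNear {n : ℕ} (I : Set ℝ) (f : ℝ → ProjSpace n) (m : ℕ) (q : ℝ)
    (e : ℝ → Matrix (Fin (n + 2)) (Fin (n + 2)) ℝ) : Prop :=
  ∃ V : Set ℝ, IsOpen V ∧ q ∈ V ∧ IsFrame I f m (I ∩ V) e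

/-- The function `p^α` of a Darboux frame, given by `φ^0_α = p^α φ^1_0`
(`φ^1_0 ≠ 0` for first order frames along immersions). -/
noncomputable def pCoeff {n : ℕ} (I : Set ℝ)
    (e : ℝ → Matrix (Fin (n + 2)) (Fin (n + 2)) ℝ) (t : ℝ) (a : ℕ) : ℝ :=
  mcForm I e t 0 a / mcForm I e t 1 0

/-- The vanishing at `q`, in the frame `e` of order `k + 1`, of the `k`-th invariant:
`∑_α (p^α)² = 0` for `k = 1`; for `k ≥ 2`, `φ^c_k = 0` for all `k + 1 ≤ c ≤ n`,
that is, `X_(k) = 0`. -/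
def InvariantVanishes {n : ℕ} (I : Set ℝ)
    (e : ℝ → Matrix (Fin (n + 2)) (Fin (n + 2)) ℝ) (q : ℝ) (k : ℕ) : Prop :=
  if k = 1 then ∑ a ∈ Finset.Icc 2 n, pCoeff I e q a ^ 2 = 0
  else ∀ c ∈ Finset.Icc (k + 1) n, mcForm I e q c k = 0

/-- The point `q` is `k`-generic for `f`: it is `(k-1)`-generic (no condition if `k = 1`), and the
`k`-th invariant, computed in a frame of order `k + 1` around `q`, does not vanish at `q`. -/
def IsGenericAt {n : ℕ} (I : Set ℝ) (f : ℝ → ProjSpace n) : ℕ → ℝ → Prop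
  | 0, _ => True
  | k + 1, q => IsGenericAt I f k q ∧
      ∃ e, IsFrameNear I f (k + 2) q e ∧ ¬ InvariantVanishes I e q (k + 1)

/-- The curve `f` is `k`-generic on `I`: every point of `I` is `k`-generic. -/
def IsGeneric {n : ℕ} (I : Set ℝ) (f : ℝ → ProjSpace n) (k : ℕ) : Prop :=
  ∀ q ∈ I, IsGenericAt I f k q

/-- The curve `f` is totally `k`-degenerate on `I` (`k ≥ 1`): it is `(k-1)`-generic (no condition
if `k = 1`) and the `k`-th invariant, computed in frames of order `k + 1`, vanishes
identically. -/
def IsTotallyDegenerate {n : ℕ} (I : Set ℝ) (f : ℝ → ProjSpace n) (k : ℕ) : Prop :=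
  IsGeneric I f (k - 1) ∧
    ∀ q ∈ I, ∃ e, IsFrameNear I f (k + 1) q e ∧ InvariantVanishes I e q k

/-! ### Lorentzian linear algebra, the light cone and the flag of index positions. -/

section LorentzAlgebra

open Matrix

variable {n : ℕ}

/-! The invariants defined by frames are translated into linear independence of derivatives of one
distinguished lift. Being an immersion, `f` has a lift `F 0` to the positive light cone with ⟨F₀',
F₀'⟩ = 1 (`exists_isNormalLift`). Write Fᵢ for its derivatives. The relations ⟨F₀, F₀⟩ = 0, ⟨F₁, F₁⟩
= 1 and ⟨F₀, F₂⟩ = -1 make F₀, F₁, F₂ independent for every curve, which is why the count starts at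
three vectors.

List the columns of a frame in the order e₀, e₁, eₙ₊₁, e₂, …, eₙ, at positions 0, 1, 2, 3, …, n + 1.
In this order the vanishing conditions on a frame of order k + 1 say that the columns of φ at
positions ≤ k are zero below the subdiagonal; the column eₙ₊₁ fits because skew-symmetry gives
φ^c_{n+1} = φ^0_c. Hence Fⱼ lies in the span of the positions ≤ j for j ≤ k + 1. The k-th invariant
is the part of the column at position k + 1 below the diagonal, and if F₀, …, F_{k+1} are
independent, it vanishes exactly when F_{k+2} depends on them
(`invariantVanishes_iff_not_jetIndependent`). Thus (k-1)-genericity forces F₀, …, F_{k+1} to be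
independent, and total k-degeneracy says that their span stops growing.

If it stops growing everywhere, φ preserves a step of the flag. By skew-symmetry it is then block
diagonal, so the projection onto that span is constant (`frameSpan_le_of_block`). Connectedness of
`I` gives one fixed subspace of dimension k + 2, spanned by frame vectors, which contains the lift;
this is a conformal k-sphere. Conversely, if the curve lies in a k-sphere, all derivatives of the
lift lie in a space of dimension k + 2, so k + 3 of them are dependent.

The converse also needs a frame of order k + 1 in which to evaluate the invariant.
`exists_isFrameNear` builds one by a Gram-Schmidt process on the derivatives, followed by a change
of scale which achieves φ^0_2 = φ^1_0 and φ^0_0 = 0. -/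

/-- The involution of the index set which exchanges `0` and `n + 1`. -/
def flipIdx (i : Fin (n + 2)) : Fin (n + 2) := Equiv.swap 0 (Fin.last (n + 1)) i

/-- The sign of the nonzero entry in a row of the Lorentzian Gram matrix. -/
def flipSign (i : Fin (n + 2)) : ℝ := if i = 0 ∨ i = Fin.last (n + 1) then -1 else 1

@[simp] lemma flipIdx_flipIdx (i : Fin (n + 2)) : flipIdx (flipIdx i) = i := by
  simp [flipIdx]

@[simp] lemma flipIdx_zero : flipIdx (0 : Fin (n + 2)) = Fin.last (n + 1) := by
  simp [flipIdx]

@[simp] lemma flipIdx_last : flipIdx (Fin.last (n + 1)) = 0 := by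
  simp [flipIdx]

lemma flipIdx_of_ne {i : Fin (n + 2)} (h0 : i ≠ 0) (h1 : i ≠ Fin.last (n + 1)) :
    flipIdx i = i := Equiv.swap_apply_of_ne_of_ne h0 h1

@[simp] lemma flipSign_flipIdx (i : Fin (n + 2)) : flipSign (flipIdx i) = flipSign i := by
  by_cases h0 : i = 0
  · subst h0; simp [flipSign]
  by_cases h1 : i = Fin.last (n + 1)
  · subst h1; simp [flipSign]
  rw [flipIdx_of_ne h0 h1]

@[simp] lemma flipSign_mul_self (i : Fin (n + 2)) : flipSign i * flipSign i = 1 := by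
  unfold flipSign; split_ifs <;> norm_num

lemma flipSign_ne_zero (i : Fin (n + 2)) : flipSign i ≠ 0 := by
  unfold flipSign; split_ifs <;> norm_num

lemma flipSign_of_ne {i : Fin (n + 2)} (h0 : i ≠ 0) (h1 : i ≠ Fin.last (n + 1)) :
    flipSign i = 1 := by simp [flipSign, h0, h1]

lemma lorentzMatrix_apply (i j : Fin (n + 2)) :
    lorentzMatrix n i j = if j = flipIdx i then flipSign i else 0 := by
  have hl : (Fin.last (n + 1)) ≠ 0 := by simp [Fin.ext_iff]
  by_cases h0 : i = 0
  · subst h0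
    by_cases hj : j = Fin.last (n + 1)
    · subst hj; simp [lorentzMatrix, flipSign]
    · simp only [lorentzMatrix, of_apply, flipIdx_zero, hj]; simp [hl.symm]
  by_cases h1 : i = Fin.last (n + 1)
  · subst h1
    by_cases hj : j = 0
    · subst hj; simp [lorentzMatrix, flipSign]
    · simp only [lorentzMatrix, of_apply, flipIdx_last, hj]; simp
  rw [flipIdx_of_ne h0 h1, flipSign_of_ne h0 h1]
  simp [lorentzMatrix, h0, h1, eq_comm]

lemma lorentzMatrix_mulVec (v : Coord n) (i : Fin (n + 2)) :
    (lorentzMatrix n *ᵥ v) i = flipSign i * v (flipIdx i) := by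
  simp [mulVec, dotProduct, lorentzMatrix_apply]

lemma lorentzMatrix_mul_apply (A : Matrix (Fin (n + 2)) (Fin (n + 2)) ℝ) (i j : Fin (n + 2)) :
    (lorentzMatrix n * A) i j = flipSign i * A (flipIdx i) j := by
  simp [mul_apply, lorentzMatrix_apply]

lemma lorentzMatrix_transpose : (lorentzMatrix n)ᵀ = lorentzMatrix n := by
  ext i j
  rw [transpose_apply, lorentzMatrix_apply, lorentzMatrix_apply]
  by_cases h : j = flipIdx i
  · subst h; simp
  · rw [if_neg h, if_neg]
    rintro rfl; exact h (by simp)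

lemma lorentzMatrix_mul_self : lorentzMatrix n * lorentzMatrix n = 1 := by
  ext i j
  rw [lorentzMatrix_mul_apply, lorentzMatrix_apply]
  by_cases h : j = i
  · subst h; simp
  · simp [h, Ne.symm h]

/-- The Lorentzian inner product as a bilinear form. -/
noncomputable def lip (n : ℕ) : LinearMap.BilinForm ℝ (Coord n) :=
  Matrix.toBilin' (lorentzMatrix n)

lemma lip_apply (u v : Coord n) : lip n u v = u ⬝ᵥ (lorentzMatrix n *ᵥ v) :=
  Matrix.toBilin'_apply' _ _ _

lemma lip_eq_sum (u v : Coord n) :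
    lip n u v = ∑ i, flipSign i * (u i * v (flipIdx i)) := by
  rw [lip_apply, dotProduct]
  refine Finset.sum_congr rfl fun i _ => ?_
  rw [lorentzMatrix_mulVec]; ring

lemma lorentzForm_eq (v : Coord n) : lorentzForm v = lip n v v := (lip_apply v v).symm

lemma lip_comm (u v : Coord n) : lip n u v = lip n v u := by
  rw [lip_apply, lip_apply, dotProduct_mulVec, ← mulVec_transpose, lorentzMatrix_transpose,
    dotProduct_comm]

lemma lip_single_left (i : Fin (n + 2)) (v : Coord n) :
    lip n (Pi.single i 1) v = flipSign i * v (flipIdx i) := by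
  rw [lip_apply, single_dotProduct, lorentzMatrix_mulVec, one_mul]

lemma lip_self_eq (v : Coord n) :
    lip n v v = ∑ A : Fin n, v A.castSucc.succ ^ 2 - 2 * v 0 * v (Fin.last (n + 1)) := by
  rw [lip_eq_sum, Fin.sum_univ_succ, Fin.sum_univ_castSucc]
  have : ∀ A : Fin n, flipSign A.castSucc.succ *
      (v A.castSucc.succ * v (flipIdx A.castSucc.succ)) = v A.castSucc.succ ^ 2 := by
    intro A
    have h0 : A.castSucc.succ ≠ 0 := Fin.succ_ne_zero _
    have h1 : A.castSucc.succ ≠ Fin.last (n + 1) := by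
      simp [Fin.ext_iff, A.2.ne]
    rw [flipIdx_of_ne h0 h1, flipSign_of_ne h0 h1]; ring
  simp only [this, Fin.succ_last, flipIdx_zero, flipIdx_last]
  simp [flipSign]; ring

/-- The time functional `v ↦ v⁰ + vⁿ⁺¹`. -/
def timeFn (n : ℕ) : Coord n →ₗ[ℝ] ℝ :=
  (LinearMap.proj 0 : (Fin (n + 2) → ℝ) →ₗ[ℝ] ℝ) + LinearMap.proj (Fin.last (n + 1))

lemma timeFn_apply (v : Coord n) : timeFn n v = v 0 + v (Fin.last (n + 1)) := rfl

lemma mem_positiveCone {v : Coord n} :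
    v ∈ positiveCone n ↔ lip n v v = 0 ∧ 0 < timeFn n v := by
  rw [← lorentzForm_eq, timeFn_apply]; rfl

/-- On the hyperplane vⁿ⁺¹ = -v⁰ the form becomes ∑ (v^A)² + 2(v⁰)², which is positive definite. -/
lemma eq_zero_of_timeFn_eq_zero {v : Coord n} (h : timeFn n v = 0) (h' : lip n v v ≤ 0) :
    v = 0 := by
  rw [lip_self_eq] at h'
  have h1 : v (Fin.last (n + 1)) = - v 0 := by rw [timeFn_apply] at h; linarith
  have hs : 0 ≤ ∑ A : Fin n, v A.castSucc.succ ^ 2 := Finset.sum_nonneg fun _ _ => sq_nonneg _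
  rw [h1] at h'
  have h0 : v 0 = 0 := by
    have : v 0 ^ 2 ≤ 0 := by nlinarith [sq_nonneg (v 0)]
    exact pow_eq_zero_iff two_ne_zero |>.1 (le_antisymm this (sq_nonneg _))
  have h2 : ∑ A : Fin n, v A.castSucc.succ ^ 2 = 0 := le_antisymm (by nlinarith) hs
  rw [Finset.sum_eq_zero_iff_of_nonneg fun _ _ => sq_nonneg _] at h2
  ext i
  refine Fin.cases h0 (fun j => ?_) i
  refine Fin.lastCases (by rw [Fin.succ_last, h1, h0]; simp) (fun A => ?_) j
  simpa using h2 A (Finset.mem_univ _)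

lemma timeFn_ne_zero_of_null {v : Coord n} (hv : v ≠ 0) (h : lip n v v = 0) :
    timeFn n v ≠ 0 := fun h0 => hv (eq_zero_of_timeFn_eq_zero h0 h.le)

/-- The part of `v` transversal to `u` inside the hyperplane `timeFn = 0`. -/
lemma lip_sub_smul_self {u v : Coord n} (hu : lip n u u = 0) (a : ℝ) :
    lip n (v - a • u) (v - a • u) = lip n v v - 2 * a * lip n u v := by
  simp only [map_sub, map_smul, LinearMap.sub_apply, LinearMap.smul_apply, smul_eq_mul, hu,
    lip_comm v u]
  ring

lemma timeFn_sub_smul {u : Coord n} (hu : timeFn n u ≠ 0) (v : Coord n) :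
    timeFn n (v - (timeFn n v / timeFn n u) • u) = 0 := by
  simp only [map_sub, map_smul, smul_eq_mul]; field_simp; ring

/-- The form is positive on `u^⊥` modulo `u`, for `u` in the light cone. -/
lemma lip_self_pos {u v : Coord n} (hu : u ∈ positiveCone n) (huv : lip n u v = 0)
    (hv : ∀ a : ℝ, v ≠ a • u) : 0 < lip n v v := by
  obtain ⟨h0, h1⟩ := mem_positiveCone.1 hu
  -- Subtracting a multiple of `u` moves `v` into the definite hyperplane `timeFn = 0`, and does not
  -- change its square since `u` is null and orthogonal to `v`.
  have h2 := timeFn_sub_smul h1.ne' v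
  have h3 := lip_sub_smul_self (v := v) h0 (timeFn n v / timeFn n u)
  rw [huv, mul_zero, sub_zero] at h3
  by_contra hlt
  have h4 := eq_zero_of_timeFn_eq_zero h2 (by rw [h3]; exact not_lt.1 hlt)
  exact hv _ (sub_eq_zero.1 h4)

lemma lip_mulVec {G : Matrix (Fin (n + 2)) (Fin (n + 2)) ℝ}
    (hG : Gᵀ * lorentzMatrix n * G = lorentzMatrix n) (u v : Coord n) :
    lip n (G *ᵥ u) (G *ᵥ v) = lip n u v := by
  rw [lip_apply, lip_apply, ← vecMul_transpose, ← dotProduct_mulVec, mulVec_mulVec, mulVec_mulVec,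
    hG]

/-- A Lorentz matrix whose first column lies in the light cone preserves the light cone. -/
lemma mulVec_mem_positiveCone {G : Matrix (Fin (n + 2)) (Fin (n + 2)) ℝ}
    (hG : Gᵀ * lorentzMatrix n * G = lorentzMatrix n)
    (h0 : (fun i => G i 0) ∈ positiveCone n) {v : Coord n} (hv : v ∈ positiveCone n) :
    G *ᵥ v ∈ positiveCone n := by
  have hcol : (fun i => G i 0) = G *ᵥ Pi.single 0 1 := by
    ext i; simp
  rw [hcol] at h0
  obtain ⟨hu0, hu1⟩ := mem_positiveCone.1 h0
  obtain ⟨hv0, hv1⟩ := mem_positiveCone.1 hv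
  have hw0 : lip n (G *ᵥ v) (G *ᵥ v) = 0 := by rw [lip_mulVec hG, hv0]
  have hinj : ∀ x y : Coord n, G *ᵥ x = G *ᵥ y → x = y := by
    intro x y hxy
    have := congrArg (fun z => lorentzMatrix n *ᵥ (Gᵀ * lorentzMatrix n) *ᵥ z) hxy
    simpa only [mulVec_mulVec, hG, lorentzMatrix_mul_self, one_mulVec, Matrix.mul_assoc,
      ← Matrix.mul_assoc Gᵀ] using this
  set u := G *ᵥ Pi.single 0 1 with hu
  set w := G *ᵥ v with hw
  refine mem_positiveCone.2 ⟨hw0, ?_⟩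
  -- If `G v` had negative time, then a = time(Gv)/time(u) < 0. The vector `G v - a u` has time zero
  -- and square 2a·vⁿ⁺¹ ≤ 0, so it vanishes. Then v = a η₀ has time a < 0, a contradiction.
  by_contra hle
  have hne : timeFn n w ≠ 0 := by
    refine timeFn_ne_zero_of_null (fun h => ?_) hw0
    have : v = 0 := hinj v 0 (by rw [mulVec_zero, ← hw, h])
    rw [this, map_zero] at hv1; exact lt_irrefl _ hv1
  have hneg : timeFn n w < 0 := lt_of_le_of_ne (not_lt.1 hle) hne
  have ha : timeFn n w / timeFn n u < 0 := div_neg_of_neg_of_pos hneg hu1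
  have h2 := timeFn_sub_smul hu1.ne' w
  have h3 := lip_sub_smul_self (v := w) hu0 (timeFn n w / timeFn n u)
  have h5 : lip n u w = - v (Fin.last (n + 1)) := by
    rw [hu, hw, lip_mulVec hG, lip_single_left]; simp [flipSign]
  have h6 : 0 ≤ v (Fin.last (n + 1)) := by
    have hs : 0 ≤ ∑ A : Fin n, v A.castSucc.succ ^ 2 :=
      Finset.sum_nonneg fun _ _ => sq_nonneg _
    rw [lip_self_eq] at hv0
    rw [timeFn_apply] at hv1
    by_contra hlt
    nlinarith
  have h7 : lip n (w - (timeFn n w / timeFn n u) • u) (w - (timeFn n w / timeFn n u) • u) ≤ 0 := by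
    rw [h3, hw0, h5]; nlinarith
  have h8 := sub_eq_zero.1 (eq_zero_of_timeFn_eq_zero h2 h7)
  have h9 : v = (timeFn n w / timeFn n u) • Pi.single 0 1 :=
    hinj _ _ (by rw [mulVec_smul, ← hu, ← hw]; exact h8)
  have h10 : timeFn n v = timeFn n w / timeFn n u := by
    conv_lhs => rw [h9]
    simp [timeFn_apply]
  linarith

/-- The inverse of a Lorentz matrix. -/
lemma inv_of_lorentz {G : Matrix (Fin (n + 2)) (Fin (n + 2)) ℝ}
    (hG : Gᵀ * lorentzMatrix n * G = lorentzMatrix n) :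
    G⁻¹ = lorentzMatrix n * (Gᵀ * lorentzMatrix n) := by
  refine Matrix.inv_eq_left_inv ?_
  rw [Matrix.mul_assoc, hG, lorentzMatrix_mul_self]

lemma inv_mul_of_lorentz {G : Matrix (Fin (n + 2)) (Fin (n + 2)) ℝ}
    (hG : Gᵀ * lorentzMatrix n * G = lorentzMatrix n) : G⁻¹ * G = 1 := by
  rw [inv_of_lorentz hG, Matrix.mul_assoc, hG, lorentzMatrix_mul_self]

lemma mul_inv_of_lorentz {G : Matrix (Fin (n + 2)) (Fin (n + 2)) ℝ}
    (hG : Gᵀ * lorentzMatrix n * G = lorentzMatrix n) : G * G⁻¹ = 1 :=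
  mul_eq_one_comm.1 (inv_mul_of_lorentz hG)

lemma inv_mulVec_apply {G : Matrix (Fin (n + 2)) (Fin (n + 2)) ℝ}
    (hG : Gᵀ * lorentzMatrix n * G = lorentzMatrix n) (v : Coord n) (c : Fin (n + 2)) :
    (G⁻¹ *ᵥ v) c = flipSign c * lip n (G.col (flipIdx c)) v := by
  rw [inv_of_lorentz hG, ← mulVec_mulVec, lorentzMatrix_mulVec, ← mulVec_mulVec, lip_apply]
  rfl

/-- The position of the index `b` in the order `0, 1, n + 1, 2, …, n`, in which the vectors of a
frame appear in the osculating flag of a curve. -/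
def flagIndex (b : Fin (n + 2)) : ℕ :=
  if b.val = 0 then 0 else if b.val = n + 1 then 2 else if b.val = 1 then 1 else b.val + 1

lemma flagIndex_injective (hn : 1 ≤ n) : Function.Injective (flagIndex (n := n)) := by
  intro a b h
  have := a.2; have := b.2
  unfold flagIndex at h
  ext
  split_ifs at h <;> omega

/-- The involution exchanges the positions 0 and 2 and fixes the others, so a step of the flag is
stable once it contains position 2. This is what later carries a vanishing block of φ to the
opposite block. -/
lemma flagIndex_flipIdx_le {m : ℕ} (hm : 2 ≤ m) {b : Fin (n + 2)} (h : flagIndex b ≤ m) :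
    flagIndex (flipIdx b) ≤ m := by
  by_cases h0 : b = 0
  · subst h0; simp [flagIndex]; omega
  by_cases h1 : b = Fin.last (n + 1)
  · subst h1; simp [flagIndex]
  rwa [flipIdx_of_ne h0 h1]

/-- Inserting eₙ₊₁ at position 2 shifts every index b with 2 ≤ b ≤ n to position b + 1; hence the k
+ 1 on both sides. -/
lemma flagIndex_gt_iff {k : ℕ} (hk : 1 ≤ k) (b : Fin (n + 2)) :
    k + 1 < flagIndex b ↔ k + 1 ≤ b.val ∧ b.val ≤ n := by
  have := b.2
  unfold flagIndex; split_ifs <;> omega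

/-- The span of the standard basis vectors at the positions `0, …, m` of the flag. -/
def flagSpace (n m : ℕ) : Submodule ℝ (Coord n) where
  carrier := {x | ∀ c, m < flagIndex c → x c = 0}
  add_mem' hx hy c hc := by simp [hx c hc, hy c hc]
  zero_mem' c _ := rfl
  smul_mem' a x hx c hc := by simp [hx c hc]

lemma finrank_flagSpace_le (hn : 1 ≤ n) (m : ℕ) : Module.finrank ℝ (flagSpace n m) ≤ m + 1 := by
  let P := {b : Fin (n + 2) // flagIndex b ≤ m}
  let r : flagSpace n m →ₗ[ℝ] (P → ℝ) :=
    (LinearMap.funLeft ℝ ℝ (Subtype.val : P → Fin (n + 2))).comp (flagSpace n m).subtype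
  have hr : Function.Injective r := by
    rw [← LinearMap.ker_eq_bot, LinearMap.ker_eq_bot']
    intro x hx
    ext c
    by_cases hc : flagIndex c ≤ m
    · exact congrFun hx ⟨c, hc⟩
    · exact x.2 c (not_le.1 hc)
  refine (LinearMap.finrank_le_finrank_of_injective hr).trans ?_
  rw [Module.finrank_fintype_fun_eq_card]
  let g : P → Fin (m + 1) := fun b => ⟨flagIndex b.1, Nat.lt_succ_of_le b.2⟩
  have hg : Function.Injective g := fun a b h =>
    Subtype.ext (flagIndex_injective hn (by simpa [g] using h))
  simpa using Fintype.card_le_of_injective g hg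

end LorentzAlgebra

/-! ### Maurer-Cartan forms of Lorentz frames, and the order conditions in Hessenberg form. -/

section MovingFrames

open Matrix

variable {n : ℕ} {I V : Set ℝ} {t : ℝ}

/-- Since `V` is open, differentiability along `I ∩ V` and along `I` agree at `t`. This makes the
derivatives along `I` in the Maurer-Cartan form usable for frames that are smooth only locally. -/
lemma hasDerivWithinAt_of_contDiffOn_inter {E : Type*} [NormedAddCommGroup E] [NormedSpace ℝ E]
    {g : ℝ → E} (hV : IsOpen V) (hg : ContDiffOn ℝ ∞ g (I ∩ V)) (ht : t ∈ I ∩ V) :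
    HasDerivWithinAt g (derivWithin g I t) I t := by
  have h := (hg.differentiableOn (by simp)) t ht
  rw [differentiableWithinAt_inter (hV.mem_nhds ht.2)] at h
  exact h.hasDerivWithinAt

lemma HasDerivWithinAt.lip {u v : ℝ → Coord n} {u' v' : Coord n}
    (hu : HasDerivWithinAt u u' I t) (hv : HasDerivWithinAt v v' I t) :
    HasDerivWithinAt (fun s => lip n (u s) (v s)) (lip n u' (v t) + lip n (u t) v') I t := by
  rw [hasDerivWithinAt_pi] at hu hv
  have h := HasDerivWithinAt.fun_sum (u := Finset.univ) (A := fun i s =>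
    flipSign i * (u s i * v s (flipIdx i))) (A' := fun i =>
      flipSign i * (u' i * v t (flipIdx i) + u t i * v' (flipIdx i))) (s := I) (x := t)
    fun i _ => ((hu i).mul (hv (flipIdx i))).const_mul _
  simp only [lip_eq_sum]
  refine h.congr_deriv ?_
  rw [← Finset.sum_add_distrib]
  exact Finset.sum_congr rfl fun i _ => by ring

lemma ContDiffOn.lip {U : Set ℝ} {u v : ℝ → Coord n} (hu : ContDiffOn ℝ ∞ u U)
    (hv : ContDiffOn ℝ ∞ v U) : ContDiffOn ℝ ∞ (fun s => lip n (u s) (v s)) U := by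
  rw [contDiffOn_pi] at hu hv
  simp only [lip_eq_sum]
  exact ContDiffOn.sum fun i _ => contDiffOn_const.mul ((hu i).mul (hv _))

/-- The Gram matrix of the columns of a Lorentz matrix. -/
lemma lorentz_iff_lip_col {G : Matrix (Fin (n + 2)) (Fin (n + 2)) ℝ} :
    Gᵀ * lorentzMatrix n * G = lorentzMatrix n ↔
      ∀ i j, lip n (G.col i) (G.col j) = lorentzMatrix n i j := by
  have : ∀ i j, (Gᵀ * lorentzMatrix n * G) i j = lip n (G.col i) (G.col j) := by
    intro i j
    rw [Matrix.mul_assoc, lip_apply]; rfl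
  constructor
  · intro h i j; rw [← this, h]
  · intro h; ext i j; rw [this, h]

/-- A smooth map into the Lorentz group on the part of `I` inside `V`. -/
structure IsLorentzFrame (I V : Set ℝ) (e : ℝ → Matrix (Fin (n + 2)) (Fin (n + 2)) ℝ) :
    Prop where
  isOpen : IsOpen V
  smooth : ∀ i j, ContDiffOn ℝ ∞ (fun t => e t i j) (I ∩ V)
  lorentz : ∀ t ∈ I ∩ V, (e t)ᵀ * lorentzMatrix n * e t = lorentzMatrix n

/-- The derivative of a column of a matrix-valued map. -/
noncomputable def colDeriv (I : Set ℝ) (e : ℝ → Matrix (Fin (n + 2)) (Fin (n + 2)) ℝ) (t : ℝ)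
    (b : Fin (n + 2)) : Coord n := fun i => derivWithin (fun s => e s i b) I t

variable {e : ℝ → Matrix (Fin (n + 2)) (Fin (n + 2)) ℝ}

lemma mulVec_eq_sum_col (G : Matrix (Fin (n + 2)) (Fin (n + 2)) ℝ) (x : Coord n) :
    G *ᵥ x = ∑ b, x b • G.col b := by
  ext i
  simp [mulVec, dotProduct, Matrix.col_apply, mul_comm]

namespace IsLorentzFrame

lemma hasDerivWithinAt_entry (he : IsLorentzFrame I V e) (ht : t ∈ I ∩ V) (i j : Fin (n + 2)) :
    HasDerivWithinAt (fun s => e s i j) (colDeriv I e t j i) I t :=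
  hasDerivWithinAt_of_contDiffOn_inter he.isOpen (he.smooth i j) ht

lemma hasDerivWithinAt_col (he : IsLorentzFrame I V e) (ht : t ∈ I ∩ V) (b : Fin (n + 2)) :
    HasDerivWithinAt (fun s => (e s).col b) (colDeriv I e t b) I t :=
  hasDerivWithinAt_pi.2 fun i => he.hasDerivWithinAt_entry ht i b

lemma maurerCartan_apply (he : IsLorentzFrame I V e) (ht : t ∈ I ∩ V) (c b : Fin (n + 2)) :
    maurerCartan I e t c b = flipSign c * lip n ((e t).col (flipIdx c)) (colDeriv I e t b) :=
  inv_mulVec_apply (he.lorentz t ht) (colDeriv I e t b) c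

lemma lip_col_colDeriv (he : IsLorentzFrame I V e) (ht : t ∈ I ∩ V) (c b : Fin (n + 2)) :
    lip n ((e t).col c) (colDeriv I e t b) = flipSign c * maurerCartan I e t (flipIdx c) b := by
  rw [he.maurerCartan_apply ht, flipIdx_flipIdx, flipSign_flipIdx, ← mul_assoc,
    flipSign_mul_self, one_mul]

lemma colDeriv_eq_mulVec (he : IsLorentzFrame I V e) (ht : t ∈ I ∩ V) (b : Fin (n + 2)) :
    colDeriv I e t b = e t *ᵥ (maurerCartan I e t).col b := by
  have : (maurerCartan I e t).col b = (e t)⁻¹ *ᵥ colDeriv I e t b := rfl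
  rw [this, mulVec_mulVec, mul_inv_of_lorentz (he.lorentz t ht), one_mulVec]

/-- The derivatives of the products of the columns vanish. -/
lemma lip_colDeriv_add (he : IsLorentzFrame I V e) (hI : UniqueDiffOn ℝ I) (ht : t ∈ I ∩ V)
    (i j : Fin (n + 2)) :
    lip n (colDeriv I e t i) ((e t).col j) + lip n ((e t).col i) (colDeriv I e t j) = 0 := by
  have h1 := (he.hasDerivWithinAt_col ht i).lip (he.hasDerivWithinAt_col ht j)
  have h2 : HasDerivWithinAt (fun s => lip n ((e s).col i) ((e s).col j)) 0 I t := by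
    refine (hasDerivWithinAt_const t I (lorentzMatrix n i j)).congr_of_eventuallyEq ?_
      (lorentz_iff_lip_col.1 (he.lorentz t ht) i j)
    filter_upwards [inter_mem_nhdsWithin I (he.isOpen.mem_nhds ht.2)] with s hs
    exact lorentz_iff_lip_col.1 (he.lorentz s hs) i j
  exact (hI t ht.1).eq_deriv _ h1 h2

lemma maurerCartan_skew (he : IsLorentzFrame I V e) (hI : UniqueDiffOn ℝ I) (ht : t ∈ I ∩ V)
    (i j : Fin (n + 2)) :
    flipSign i * maurerCartan I e t (flipIdx i) j
      + flipSign j * maurerCartan I e t (flipIdx j) i = 0 := by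
  rw [← he.lip_col_colDeriv ht, ← he.lip_col_colDeriv ht, ← he.lip_colDeriv_add hI ht j i,
    lip_comm _ ((e t).col i)]

lemma maurerCartan_last_zero (he : IsLorentzFrame I V e) (hI : UniqueDiffOn ℝ I)
    (ht : t ∈ I ∩ V) : maurerCartan I e t (Fin.last (n + 1)) 0 = 0 := by
  have h := he.maurerCartan_skew hI ht 0 0
  simp only [flipSign, flipIdx_zero] at h
  simp at h; linarith

lemma maurerCartan_apply_last (he : IsLorentzFrame I V e) (hI : UniqueDiffOn ℝ I)
    (ht : t ∈ I ∩ V) {c : Fin (n + 2)} (h0 : c ≠ 0) (h1 : c ≠ Fin.last (n + 1)) :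
    maurerCartan I e t c (Fin.last (n + 1)) = maurerCartan I e t 0 c := by
  have h := he.maurerCartan_skew hI ht c (Fin.last (n + 1))
  rw [flipIdx_of_ne h0 h1, flipSign_of_ne h0 h1, flipIdx_last] at h
  simp [flipSign] at h; linarith

/-- The derivative of the components of a vector function with respect to a frame. -/
lemma hasDerivWithinAt_inv_mulVec (he : IsLorentzFrame I V e) (hI : UniqueDiffOn ℝ I)
    (ht : t ∈ I ∩ V) {w : ℝ → Coord n} {w' : Coord n} (hw : HasDerivWithinAt w w' I t)
    (c : Fin (n + 2)) :
    HasDerivWithinAt (fun s => ((e s)⁻¹ *ᵥ w s) c)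
      (((e t)⁻¹ *ᵥ w') c - (maurerCartan I e t *ᵥ ((e t)⁻¹ *ᵥ w t)) c) I t := by
  have h1 := ((he.hasDerivWithinAt_col ht (flipIdx c)).lip hw).const_mul (flipSign c)
  have h2 : HasDerivWithinAt (fun s => ((e s)⁻¹ *ᵥ w s) c)
      (flipSign c * (lip n (colDeriv I e t (flipIdx c)) (w t)
        + lip n ((e t).col (flipIdx c)) w')) I t := by
    refine h1.congr_of_eventuallyEq ?_ (inv_mulVec_apply (he.lorentz t ht) _ _)
    filter_upwards [inter_mem_nhdsWithin I (he.isOpen.mem_nhds ht.2)] with s hs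
    exact inv_mulVec_apply (he.lorentz s hs) _ _
  convert h2 using 1
  -- Expanding w in the frame, the term with the differentiated column becomes a row of φ, because
  -- ⟨e_c', e_b⟩ = -⟨e_c, e_b'⟩.
  have h3 : w t = ∑ b, ((e t)⁻¹ *ᵥ w t) b • (e t).col b := by
    rw [← mulVec_eq_sum_col, mulVec_mulVec, mul_inv_of_lorentz (he.lorentz t ht), one_mulVec]
  have h4 : lip n (colDeriv I e t (flipIdx c)) (w t)
      = - (flipSign c * (maurerCartan I e t *ᵥ ((e t)⁻¹ *ᵥ w t)) c) := by
    conv_lhs => rw [h3]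
    rw [map_sum, mulVec, dotProduct, Finset.mul_sum, ← Finset.sum_neg_distrib]
    refine Finset.sum_congr rfl fun b _ => ?_
    have h5 := he.lip_colDeriv_add hI ht (flipIdx c) b
    rw [he.lip_col_colDeriv ht, flipIdx_flipIdx, flipSign_flipIdx] at h5
    rw [map_smul, smul_eq_mul, eq_neg_of_add_eq_zero_left h5]; ring
  rw [h4, inv_mulVec_apply (he.lorentz t ht) w', mul_add, mul_neg, ← mul_assoc,
    flipSign_mul_self]
  ring

/-- If a component of `w` vanishes identically, the same component of `w'` is given by the
connection form. -/
lemma inv_mulVec_deriv_apply (he : IsLorentzFrame I V e) (hI : UniqueDiffOn ℝ I)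
    (ht : t ∈ I ∩ V) {w : ℝ → Coord n} {w' : Coord n} (hw : HasDerivWithinAt w w' I t)
    {c : Fin (n + 2)} (hc : ∀ s ∈ I ∩ V, ((e s)⁻¹ *ᵥ w s) c = 0) :
    ((e t)⁻¹ *ᵥ w') c = (maurerCartan I e t *ᵥ ((e t)⁻¹ *ᵥ w t)) c := by
  have h1 := he.hasDerivWithinAt_inv_mulVec hI ht hw c
  have h2 : HasDerivWithinAt (fun s => ((e s)⁻¹ *ᵥ w s) c) 0 I t := by
    refine (hasDerivWithinAt_const t I (0 : ℝ)).congr_of_eventuallyEq ?_ (hc t ht)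
    filter_upwards [inter_mem_nhdsWithin I (he.isOpen.mem_nhds ht.2)] with s hs
    exact hc s hs
  exact sub_eq_zero.1 ((hI t ht.1).eq_deriv _ h1 h2)

end IsLorentzFrame

/-- The columns at the positions `≤ m` of the flag have vanishing components below the
subdiagonal. -/
def IsHessenberg (m : ℕ) (φ : Matrix (Fin (n + 2)) (Fin (n + 2)) ℝ) : Prop :=
  ∀ b c, flagIndex b ≤ m → flagIndex b + 1 < flagIndex c → φ c b = 0

variable {f : ℝ → ProjSpace n}

lemma mcForm_val (I : Set ℝ) (e : ℝ → Matrix (Fin (n + 2)) (Fin (n + 2)) ℝ) (t : ℝ)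
    (a b : Fin (n + 2)) : mcForm I e t a b = maurerCartan I e t a b := by
  rw [mcForm]; congr 1 <;> simp

lemma mcForm_of_lt (I : Set ℝ) (e : ℝ → Matrix (Fin (n + 2)) (Fin (n + 2)) ℝ) (t : ℝ)
    {a b : ℕ} (ha : a < n + 2) (hb : b < n + 2) :
    mcForm I e t a b = maurerCartan I e t ⟨a, ha⟩ ⟨b, hb⟩ := mcForm_val I e t ⟨a, ha⟩ ⟨b, hb⟩

lemma isFrame_of_succ {m : ℕ} {U : Set ℝ} (h : IsFrame I f (m + 1) U e) : IsFrame I f m U e := by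
  match m, h with
  | 0, h => exact h.1
  | 1, h => exact h.1
  | 2, h => exact h.1
  | 3, h => exact h.1
  | m + 4, h => exact h.1

lemma isFrame_mono {U U' : Set ℝ} (hU : U' ⊆ U) :
    ∀ m : ℕ, IsFrame I f m U e → IsFrame I f m U' e
  | 0, h => ⟨fun i j => (h.1 i j).mono hU, fun t ht => h.2 t (hU ht)⟩
  | 1, h => ⟨isFrame_mono hU 0 h.1, fun t ht => h.2 t (hU ht)⟩
  | 2, h => ⟨isFrame_mono hU 1 h.1, fun t ht => h.2 t (hU ht)⟩
  | 3, h => ⟨isFrame_mono hU 2 h.1, fun t ht => h.2 t (hU ht)⟩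
  | 4, h => ⟨isFrame_mono hU 3 h.1, fun t ht => h.2 t (hU ht)⟩
  | m + 5, h => ⟨isFrame_mono hU (m + 4) h.1, fun t ht => h.2 t (hU ht)⟩

lemma isFrame_of_le {m m' : ℕ} {U : Set ℝ} (hm : m ≤ m') (h : IsFrame I f m' U e) :
    IsFrame I f m U e := by
  induction m', hm using Nat.le_induction with
  | base => exact h
  | succ k _ ih => exact ih (isFrame_of_succ h)

lemma isLorentzFrame_of_isFrame {m : ℕ} (hV : IsOpen V) (h : IsFrame I f m (I ∩ V) e) :
    IsLorentzFrame I V e := by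
  have h0 := isFrame_of_le (Nat.zero_le m) h
  exact ⟨hV, h0.1, fun t ht => (h0.2 t ht).1.1⟩

lemma flagIndex_cases (hn : 1 ≤ n) (b : Fin (n + 2)) :
    (flagIndex b = 0 ∧ b = 0) ∨ (flagIndex b = 1 ∧ b.val = 1) ∨
      (flagIndex b = 2 ∧ b = Fin.last (n + 1)) ∨
      (flagIndex b = b.val + 1 ∧ 2 ≤ b.val ∧ b.val ≤ n) := by
  have := b.2
  simp only [flagIndex, Fin.ext_iff, Fin.val_last, Fin.val_zero]
  split_ifs <;> omega

/-- The conditions on the frames of order `m + 1`, as the vanishing of a triangle. -/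
lemma isHessenberg_of_isFrame (hn : 1 ≤ n) {m : ℕ} (hm : 1 ≤ m) (hI : UniqueDiffOn ℝ I)
    (hV : IsOpen V) (h : IsFrame I f (m + 1) (I ∩ V) e) (ht : t ∈ I ∩ V) :
    IsHessenberg m (maurerCartan I e t) := by
  have he := isLorentzFrame_of_isFrame hV h
  intro b c hb hbc
  have hc := c.2
  rw [← mcForm_val]
  rcases flagIndex_cases hn b with ⟨h1, h2⟩ | ⟨h1, h2⟩ | ⟨h1, h2⟩ | ⟨h1, h2, h3⟩ <;>
  rcases flagIndex_cases hn c with ⟨k1, k2⟩ | ⟨k1, k2⟩ | ⟨k1, k2⟩ | ⟨k1, k2, k3⟩ <;>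
  rw [h1] at hb <;> rw [h1, k1] at hbc <;> try omega
  -- The surviving pairs of positions (column, row) are (0, 2), (0, ≥ 3), (1, ≥ 3), (2, ≥ 4), and
  -- both ≥ 3. The first vanishes by skew-symmetry, the others by the conditions of orders 1, 2, 3,
  -- and ≥ 4.
  · subst h2; subst k2; rw [mcForm_val]; exact he.maurerCartan_last_zero hI ht
  · subst h2
    exact (isFrame_of_le (show 1 ≤ m + 1 by omega) h).2 t ht c (Finset.mem_Icc.2 ⟨k2, k3⟩)
  · rw [h2]
    exact (isFrame_of_le (show 2 ≤ m + 1 by omega) h).2 t ht c (Finset.mem_Icc.2 ⟨k2, k3⟩)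
  · subst h2
    rw [mcForm_val, he.maurerCartan_apply_last hI ht (by rintro rfl; simp at k2)
      (by rintro rfl; simp at k3), ← mcForm_val]
    exact ((isFrame_of_le (show 3 ≤ m + 1 by omega) h).2 t ht).2 c
      (Finset.mem_Icc.2 ⟨by omega, k3⟩)
  -- The column b = 2 is constrained at order 4, together with φ^0_0; each column j + 3 is
  -- constrained at order j + 5.
  · obtain h4 | ⟨j, h4⟩ : b.val = 2 ∨ ∃ j, b.val = j + 3 := by
      rcases Nat.lt_or_ge b.val 3 with h5 | h5
      · left; omega
      · exact Or.inr ⟨b.val - 3, by omega⟩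
    · rw [h4]
      exact ((isFrame_of_le (show 4 ≤ m + 1 by omega) h).2 t ht).2 c
        (Finset.mem_Icc.2 ⟨by omega, k3⟩)
    · rw [h4]
      exact (isFrame_of_le (show j + 5 ≤ m + 1 by omega) h).2 t ht c
        (Finset.mem_Icc.2 ⟨by omega, k3⟩)

/-- The triangle of zeros contains every order condition except the two normalizations φ^0_2 = φ^1_0
and φ^0_0 = 0, which are therefore separate hypotheses. The condition φ^0_a = 0 for a ≥ 3 is read
off the column n + 1. -/
lemma isFrame_of_isHessenberg (hn : 1 ≤ n) {m : ℕ} (hm : 1 ≤ m) (hI : UniqueDiffOn ℝ I)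
    (hV : IsOpen V) (h : IsFrame I f 0 (I ∩ V) e)
    (hH : ∀ t ∈ I ∩ V, IsHessenberg m (maurerCartan I e t))
    (h3 : 2 ≤ m → ∀ t ∈ I ∩ V, mcForm I e t 0 2 = mcForm I e t 1 0 ∧ mcForm I e t 0 0 = 0) :
    IsFrame I f (m + 1) (I ∩ V) e := by
  have he := isLorentzFrame_of_isFrame hV h
  have key : ∀ t ∈ I ∩ V, ∀ b c : ℕ, (hb : b < n + 2) → (hc : c < n + 2) →
      flagIndex (⟨b, hb⟩ : Fin (n + 2)) ≤ m →
      flagIndex (⟨b, hb⟩ : Fin (n + 2)) + 1 < flagIndex (⟨c, hc⟩ : Fin (n + 2)) →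
      mcForm I e t c b = 0 := by
    intro t ht b c hb hc h1 h2
    rw [mcForm_of_lt I e t hc hb]
    exact hH t ht _ _ h1 h2
  have f1 : IsFrame I f 1 (I ∩ V) e := by
    refine ⟨h, fun t ht a ha => ?_⟩
    rw [Finset.mem_Icc] at ha
    refine key t ht 0 a (by omega) (by omega) ?_ ?_ <;> simp only [flagIndex] <;>
      split_ifs <;> omega
  have f2 : IsFrame I f 2 (I ∩ V) e := by
    refine ⟨f1, fun t ht a ha => ?_⟩
    rw [Finset.mem_Icc] at ha
    refine key t ht 1 a (by omega) (by omega) ?_ ?_ <;> simp only [flagIndex] <;>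
      split_ifs <;> omega
  obtain rfl | hm2 : m = 1 ∨ 2 ≤ m := by omega
  · exact f2
  have f3 : IsFrame I f 3 (I ∩ V) e := by
    refine ⟨f2, fun t ht => ⟨(h3 hm2 t ht).1, fun a ha => ?_⟩⟩
    rw [Finset.mem_Icc] at ha
    have hlt : a < n + 2 := by omega
    have h5 := he.maurerCartan_apply_last hI ht (c := ⟨a, hlt⟩) (by simp [Fin.ext_iff]; omega)
      (by simp [Fin.ext_iff]; omega)
    rw [mcForm_of_lt I e t (by omega) hlt]
    refine h5.symm.trans (hH t ht _ _ ?_ ?_) <;> simp only [flagIndex, Fin.val_last] <;>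
      split_ifs <;> omega
  have f4 : 3 ≤ m → IsFrame I f 4 (I ∩ V) e := by
    refine fun hm3 => ⟨f3, fun t ht => ⟨(h3 hm2 t ht).2, fun a ha => ?_⟩⟩
    rw [Finset.mem_Icc] at ha
    refine key t ht 2 a (by omega) (by omega) ?_ ?_ <;> simp only [flagIndex] <;>
      split_ifs <;> omega
  have f5 : ∀ j, j + 3 ≤ m → IsFrame I f (j + 4) (I ∩ V) e := by
    intro j
    induction j with
    | zero => exact fun h => f4 h
    | succ j ih =>
      refine fun hj => ⟨ih (by omega), fun t ht a ha => ?_⟩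
      rw [Finset.mem_Icc] at ha
      refine key t ht (j + 3) a (by omega) (by omega) ?_ ?_ <;> simp only [flagIndex] <;>
        split_ifs <;> omega
  obtain rfl | hm3 : m = 2 ∨ 3 ≤ m := by omega
  · exact f3
  · obtain ⟨j, rfl⟩ := Nat.exists_eq_add_of_le' hm3
    exact f5 j le_rfl

end MovingFrames

/-! ### Osculating spaces of the normal lift, and their relation to the invariants. -/

section OsculatingSpaces

open Matrix

variable {n : ℕ} {I V : Set ℝ} {t : ℝ} {f : ℝ → ProjSpace n} {F : ℕ → ℝ → Coord n}
  {e : ℝ → Matrix (Fin (n + 2)) (Fin (n + 2)) ℝ}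

/-- `F 0` is the lift of the curve `f` to the positive light cone whose derivative has unit length,
and `F i` is its `i`-th derivative. -/
structure IsNormalLift (I : Set ℝ) (f : ℝ → ProjSpace n) (F : ℕ → ℝ → Coord n) : Prop where
  smooth : ∀ i, ContDiffOn ℝ ∞ (F i) I
  deriv : ∀ i, ∀ t ∈ I, HasDerivWithinAt (F i) (F (i + 1) t) I t
  mem_cone : ∀ t ∈ I, F 0 t ∈ positiveCone n
  represents : ∀ t ∈ I, Represents (F 0 t) (f t)
  unit : ∀ t ∈ I, lip n (F 1 t) (F 1 t) = 1

/-- The first `m` derivatives `F 0, …, F (m - 1)` are linearly independent at `t`. -/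
def JetIndependent (F : ℕ → ℝ → Coord n) (m : ℕ) (t : ℝ) : Prop :=
  LinearIndependent ℝ fun i : Fin m => F i t

/-- The span of the first `m` derivatives. -/
def jetSpan (F : ℕ → ℝ → Coord n) (m : ℕ) (t : ℝ) : Submodule ℝ (Coord n) :=
  Submodule.span ℝ (Set.range fun i : Fin m => F i t)

lemma jetIndependent_succ_iff {m : ℕ} :
    JetIndependent F (m + 1) t ↔ JetIndependent F m t ∧ F m t ∉ jetSpan F m t :=
  linearIndependent_finSucc'

lemma JetIndependent.of_le {m m' : ℕ} (h : JetIndependent F m' t) (hm : m ≤ m') :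
    JetIndependent F m t :=
  LinearIndependent.comp h (Fin.castLE hm) (Fin.castLE_injective hm)

lemma jetSpan_le_iff {m : ℕ} {W : Submodule ℝ (Coord n)} :
    jetSpan F m t ≤ W ↔ ∀ i < m, F i t ∈ W := by
  rw [jetSpan, Submodule.span_le, Set.range_subset_iff]
  exact ⟨fun h i hi => h ⟨i, hi⟩, fun h i => h i i.2⟩

lemma mem_jetSpan {m i : ℕ} (hi : i < m) : F i t ∈ jetSpan F m t :=
  Submodule.subset_span ⟨⟨i, hi⟩, rfl⟩

lemma JetIndependent.le_of_mem {m : ℕ} (h : JetIndependent F m t) {W : Submodule ℝ (Coord n)}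
    {d : ℕ} (hW : Module.finrank ℝ W ≤ d) (hF : ∀ i < m, F i t ∈ W) : m ≤ d := by
  have h1 : Module.finrank ℝ (jetSpan F m t) = m := by
    rw [jetSpan, finrank_span_eq_card h, Fintype.card_fin]
  rw [← h1]
  exact (Submodule.finrank_mono (jetSpan_le_iff.2 hF)).trans hW

/-- The span of the vectors of the frame `G` at the positions `≤ m` of the flag. -/
def frameSpan (G : Matrix (Fin (n + 2)) (Fin (n + 2)) ℝ) (m : ℕ) : Submodule ℝ (Coord n) :=
  (flagSpace n m).map G.mulVecLin

lemma mem_frameSpan {G : Matrix (Fin (n + 2)) (Fin (n + 2)) ℝ}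
    (hG : Gᵀ * lorentzMatrix n * G = lorentzMatrix n) {m : ℕ} {v : Coord n} :
    v ∈ frameSpan G m ↔ G⁻¹ *ᵥ v ∈ flagSpace n m := by
  rw [frameSpan, Submodule.mem_map]
  constructor
  · rintro ⟨x, hx, rfl⟩
    rwa [mulVecLin_apply, mulVec_mulVec, inv_mul_of_lorentz hG, one_mulVec]
  · intro h
    exact ⟨_, h, by rw [mulVecLin_apply, mulVec_mulVec, mul_inv_of_lorentz hG, one_mulVec]⟩

lemma finrank_frameSpan_le (hn : 1 ≤ n) (G : Matrix (Fin (n + 2)) (Fin (n + 2)) ℝ) (m : ℕ) :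
    Module.finrank ℝ (frameSpan G m) ≤ m + 1 :=
  (Submodule.finrank_map_le _ _).trans (finrank_flagSpace_le hn m)

lemma flagSpace_mono {m m' : ℕ} (h : m ≤ m') : flagSpace n m ≤ flagSpace n m' :=
  fun _ hx c hc => hx c (by omega)

lemma represents_iff_of_represents {v w : Coord n} {x : ProjSpace n} (hv : Represents v x) :
    Represents w x ↔ ∃ a : ℝ, a ≠ 0 ∧ w = a • v := by
  obtain ⟨hv0, rfl⟩ := hv
  constructor
  · rintro ⟨hw0, h⟩
    obtain ⟨a, ha⟩ := (Projectivization.mk_eq_mk_iff' ℝ w v hw0 hv0).1 h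
    exact ⟨a, fun h0 => hw0 (by rw [← ha, h0, zero_smul]), ha.symm⟩
  · rintro ⟨a, ha, rfl⟩
    exact ⟨smul_ne_zero ha hv0, (Projectivization.mk_eq_mk_iff' ℝ _ v _ hv0).2 ⟨a, rfl⟩⟩

/-- The lift is a multiple of the first vector of a frame along the curve. -/
lemma lift_mem_flagSpace_zero (hF : IsNormalLift I f F) (hV : IsOpen V) {m : ℕ}
    (h : IsFrame I f m (I ∩ V) e) (ht : t ∈ I ∩ V) : (e t)⁻¹ *ᵥ F 0 t ∈ flagSpace n 0 := by
  have h0 := ((isFrame_of_le (Nat.zero_le m) h).2 t ht).2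
  obtain ⟨a, -, ha⟩ := (represents_iff_of_represents h0).1 (hF.represents t ht.1)
  have hcol : (fun i => e t i 0) = e t *ᵥ Pi.single 0 1 := by ext i; simp
  rw [ha, hcol, mulVec_smul, mulVec_mulVec,
    inv_mul_of_lorentz ((isLorentzFrame_of_isFrame hV h).lorentz t ht), one_mulVec]
  intro c hc
  have : c ≠ 0 := by rintro rfl; simp [flagIndex] at hc
  simp [this]

/-- If xⱼ are the components of Fⱼ in the frame, then xⱼ₊₁ = xⱼ' + φ xⱼ. A Hessenberg φ pushes the
support of xⱼ by at most one position. -/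
lemma lift_mem_flagSpace (he : IsLorentzFrame I V e) (hI : UniqueDiffOn ℝ I)
    (hF : IsNormalLift I f F) {m : ℕ}
    (h0 : ∀ t ∈ I ∩ V, (e t)⁻¹ *ᵥ F 0 t ∈ flagSpace n 0)
    (hH : ∀ t ∈ I ∩ V, IsHessenberg m (maurerCartan I e t)) :
    ∀ j ≤ m + 1, ∀ t ∈ I ∩ V, (e t)⁻¹ *ᵥ F j t ∈ flagSpace n j := by
  intro j
  induction j with
  | zero => exact fun _ => h0
  | succ j ih =>
    intro hj t ht c hc
    have ih' := ih (by omega)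
    rw [he.inv_mulVec_deriv_apply hI ht (hF.deriv j t ht.1)
      (fun s hs => ih' s hs c (by omega)), mulVec, dotProduct]
    refine Finset.sum_eq_zero fun b _ => ?_
    rcases Nat.lt_or_ge j (flagIndex b) with h1 | h1
    · rw [ih' t ht b h1, mul_zero]
    · rw [hH t ht b c (by omega) (by omega), zero_mul]

/-- The first component of the `(m + 2)`-nd derivative outside the osculating space. -/
lemma lift_succ_apply (hn : 1 ≤ n) (he : IsLorentzFrame I V e) (hI : UniqueDiffOn ℝ I)
    (hF : IsNormalLift I f F) {m : ℕ}
    (h0 : ∀ t ∈ I ∩ V, (e t)⁻¹ *ᵥ F 0 t ∈ flagSpace n 0)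
    (hH : ∀ t ∈ I ∩ V, IsHessenberg m (maurerCartan I e t)) (ht : t ∈ I ∩ V) {j : ℕ}
    (hj : j ≤ m + 1) {b c : Fin (n + 2)} (hb : flagIndex b = j) (hc : j < flagIndex c) :
    ((e t)⁻¹ *ᵥ F (j + 1) t) c = maurerCartan I e t c b * ((e t)⁻¹ *ᵥ F j t) b := by
  have ih' := lift_mem_flagSpace he hI hF h0 hH j hj
  rw [he.inv_mulVec_deriv_apply hI ht (hF.deriv j t ht.1) (fun s hs => ih' s hs c hc), mulVec,
    dotProduct]
  refine Finset.sum_eq_single b (fun b' _ hbb => ?_) (by simp)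
  have hne : flagIndex b' ≠ j := fun h => hbb (flagIndex_injective hn (h.trans hb.symm))
  rcases Nat.lt_or_ge j (flagIndex b') with h1 | h1
  · rw [ih' t ht b' h1, mul_zero]
  · rw [hH t ht b' c (by omega) (by omega), zero_mul]

/-- Were the leading component zero, the j + 2 independent vectors F₀, …, Fⱼ₊₁ would lie in the span
of j + 1 frame vectors. -/
lemma diag_ne_zero_of_mem_flagSpace (hn : 1 ≤ n) {G : Matrix (Fin (n + 2)) (Fin (n + 2)) ℝ}
    (hG : Gᵀ * lorentzMatrix n * G = lorentzMatrix n) {j : ℕ}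
    (hmem : ∀ i ≤ j + 1, G⁻¹ *ᵥ F i t ∈ flagSpace n i) (hind : JetIndependent F (j + 2) t)
    {b : Fin (n + 2)} (hb : flagIndex b = j + 1) : (G⁻¹ *ᵥ F (j + 1) t) b ≠ 0 := by
  intro hzero
  have := hind.le_of_mem (finrank_frameSpan_le hn G j) fun i hi => by
    rw [mem_frameSpan hG]
    rcases Nat.lt_or_ge i (j + 1) with h1 | h1
    · exact flagSpace_mono (by omega) (hmem i (by omega))
    · obtain rfl : i = j + 1 := by omega
      intro c hc
      rcases eq_or_ne (flagIndex c) (j + 1) with h2 | h2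
      · rwa [flagIndex_injective hn (h2.trans hb.symm)]
      · exact hmem (j + 1) le_rfl c (by omega)
  omega

lemma lift_diag_ne_zero (hn : 1 ≤ n) (he : IsLorentzFrame I V e) (hI : UniqueDiffOn ℝ I)
    (hF : IsNormalLift I f F) {m : ℕ}
    (h0 : ∀ t ∈ I ∩ V, (e t)⁻¹ *ᵥ F 0 t ∈ flagSpace n 0)
    (hH : ∀ t ∈ I ∩ V, IsHessenberg m (maurerCartan I e t)) (ht : t ∈ I ∩ V) {j : ℕ}
    (hj : j ≤ m) (hind : JetIndependent F (j + 2) t) {b : Fin (n + 2)}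
    (hb : flagIndex b = j + 1) : ((e t)⁻¹ *ᵥ F (j + 1) t) b ≠ 0 :=
  diag_ne_zero_of_mem_flagSpace hn (he.lorentz t ht)
    (fun i hi => lift_mem_flagSpace he hI hF h0 hH i (by omega) t ht) hind hb

/-- The osculating space stops growing if and only if the next entries of the connection form
vanish. -/
lemma not_jetIndependent_iff (hn : 1 ≤ n) (he : IsLorentzFrame I V e) (hI : UniqueDiffOn ℝ I)
    (hF : IsNormalLift I f F) {m : ℕ}
    (h0 : ∀ t ∈ I ∩ V, (e t)⁻¹ *ᵥ F 0 t ∈ flagSpace n 0)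
    (hH : ∀ t ∈ I ∩ V, IsHessenberg m (maurerCartan I e t)) (ht : t ∈ I ∩ V)
    (hind : JetIndependent F (m + 2) t) {b : Fin (n + 2)} (hb : flagIndex b = m + 1) :
    (∀ c, m + 1 < flagIndex c → maurerCartan I e t c b = 0) ↔ ¬ JetIndependent F (m + 3) t := by
  have hmem := lift_mem_flagSpace he hI hF h0 hH
  constructor
  · intro h hind'
    have := hind'.le_of_mem (finrank_frameSpan_le hn (e t) (m + 1)) fun i hi => by
      rw [mem_frameSpan (he.lorentz t ht)]
      rcases Nat.lt_or_ge i (m + 2) with h1 | h1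
      · exact flagSpace_mono (by omega) (hmem i (by omega) t ht)
      · obtain rfl : i = m + 1 + 1 := by omega
        intro c hc
        rw [lift_succ_apply hn he hI hF h0 hH ht le_rfl hb hc, h c hc, zero_mul]
    omega
  · intro h c hc
    rw [jetIndependent_succ_iff, not_and, not_not] at h
    -- Dependence puts F_{m+2} into the span of the positions ≤ m + 1. Its components beyond are the
    -- entries of column `b` times the leading component of F_{m+1}, which is nonzero.
    have h1 : jetSpan F (m + 2) t ≤ frameSpan (e t) (m + 1) := jetSpan_le_iff.2 fun i hi => by
      rw [mem_frameSpan (he.lorentz t ht)]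
      exact flagSpace_mono (by omega) (hmem i (by omega) t ht)
    have h2 := (mem_frameSpan (he.lorentz t ht)).1 (h1 (h hind)) c hc
    rw [lift_succ_apply hn he hI hF h0 hH ht le_rfl hb hc] at h2
    exact (mul_eq_zero.1 h2).resolve_right (lift_diag_ne_zero hn he hI hF h0 hH ht le_rfl hind hb)

lemma exists_flagIndex_eq {m : ℕ} (hm : 1 ≤ m) (hmn : m ≤ n) :
    ∃ b : Fin (n + 2), flagIndex b = m + 1 := by
  rcases Nat.lt_or_ge 1 m with h | h
  · refine ⟨⟨m, by omega⟩, ?_⟩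
    simp only [flagIndex]; split_ifs <;> omega
  · refine ⟨Fin.last (n + 1), ?_⟩
    simp [flagIndex]; omega

/-- The `m`-th invariant of a frame, as a column of the connection form. -/
lemma invariantVanishes_iff (hn : 2 ≤ n) (he : IsLorentzFrame I V e) (hI : UniqueDiffOn ℝ I)
    {m : ℕ} (hm : 1 ≤ m) (ht : t ∈ I ∩ V) (h10 : mcForm I e t 1 0 ≠ 0) {b : Fin (n + 2)}
    (hb : flagIndex b = m + 1) :
    InvariantVanishes I e t m ↔ ∀ c, m + 1 < flagIndex c → maurerCartan I e t c b = 0 := by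
  unfold InvariantVanishes
  split_ifs with h1
  -- For m = 1 the column at position 2 is eₙ₊₁, whose entries are φ^c_{n+1} = φ^0_c = p^c φ^1_0;
  -- for m ≥ 2 the column at position m + 1 is the one of index m.
  · subst h1
    obtain rfl : b = Fin.last (n + 1) := by
      apply flagIndex_injective (by omega); rw [hb]; simp [flagIndex]
    rw [Finset.sum_eq_zero_iff_of_nonneg fun _ _ => sq_nonneg _]
    constructor
    · intro h c hc
      obtain ⟨k1, k2⟩ := (flagIndex_gt_iff le_rfl c).1 hc
      have h2 := h c (Finset.mem_Icc.2 ⟨k1, k2⟩)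
      rw [pow_eq_zero_iff two_ne_zero, pCoeff, div_eq_zero_iff, or_iff_left h10] at h2
      rw [he.maurerCartan_apply_last hI ht (by rintro rfl; simp at k1) (by rintro rfl; simp at k2),
        ← mcForm_val]
      exact h2
    · intro h a ha
      rw [Finset.mem_Icc] at ha
      have hlt : a < n + 2 := by omega
      have h2 := h ⟨a, hlt⟩ ((flagIndex_gt_iff le_rfl _).2 ha)
      rw [he.maurerCartan_apply_last hI ht (by simp [Fin.ext_iff]; omega)
        (by simp [Fin.ext_iff]; omega), ← mcForm_val] at h2
      rw [pow_eq_zero_iff two_ne_zero, pCoeff, div_eq_zero_iff]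
      exact Or.inl h2
  · have hbm : b.val = m := by
      have := flagIndex_cases (by omega) b
      omega
    constructor
    · intro h c hc
      have := h c (Finset.mem_Icc.2 ((flagIndex_gt_iff hm c).1 hc))
      rwa [← hbm, mcForm_val] at this
    · intro h a ha
      rw [Finset.mem_Icc] at ha
      have hlt : a < n + 2 := by omega
      have h2 := h ⟨a, hlt⟩ ((flagIndex_gt_iff hm _).2 ha)
      rwa [← mcForm_val, hbm] at h2

/-- In a frame of order `m + 1`, the `m`-th invariant vanishes at a point where the osculating
space is of maximal dimension so far if and only if the osculating space does not grow. -/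
lemma invariantVanishes_iff_not_jetIndependent (hn : 2 ≤ n) (hI : UniqueDiffOn ℝ I)
    (hV : IsOpen V) (hF : IsNormalLift I f F) {m : ℕ} (hm : 1 ≤ m) (hmn : m ≤ n)
    (h : IsFrame I f (m + 1) (I ∩ V) e) (ht : t ∈ I ∩ V) (hind : JetIndependent F (m + 2) t) :
    InvariantVanishes I e t m ↔ ¬ JetIndependent F (m + 3) t := by
  have he := isLorentzFrame_of_isFrame hV h
  have h0 : ∀ t ∈ I ∩ V, (e t)⁻¹ *ᵥ F 0 t ∈ flagSpace n 0 := fun t ht =>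
    lift_mem_flagSpace_zero hF hV h ht
  have hH : ∀ t ∈ I ∩ V, IsHessenberg m (maurerCartan I e t) := fun t ht =>
    isHessenberg_of_isFrame (by omega) hm hI hV h ht
  obtain ⟨b, hb⟩ := exists_flagIndex_eq hm hmn
  rw [← not_jetIndependent_iff (by omega) he hI hF h0 hH ht hind hb]
  refine invariantVanishes_iff hn he hI hm ht ?_ hb
  -- The component of F₁ at position 1 is φ^1_0 times the component of F₀ at position 0, so φ^1_0 =
  -- 0 would contradict the independence of F₀ and F₁.
  intro h10
  have i1 : flagIndex (1 : Fin (n + 2)) = 0 + 1 := by simp [flagIndex]; omega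
  have h1 := lift_diag_ne_zero (by omega) he hI hF h0 hH ht (Nat.zero_le m)
    (hind.of_le (by omega)) i1
  refine h1 ?_
  rw [lift_succ_apply (by omega) he hI hF h0 hH ht (Nat.zero_le _) (b := 0) (by simp [flagIndex])
    (by rw [i1]; exact Nat.zero_lt_one), ← mcForm_val]
  have : mcForm I e t ((1 : Fin (n + 2)) : ℕ) ((0 : Fin (n + 2)) : ℕ) = mcForm I e t 1 0 := by simp
  rw [this, h10, zero_mul]

lemma jetSpan_eq_frameSpan (hn : 1 ≤ n) {G : Matrix (Fin (n + 2)) (Fin (n + 2)) ℝ} {m : ℕ}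
    (hind : JetIndependent F (m + 1) t) (h : ∀ i < m + 1, F i t ∈ frameSpan G m) :
    jetSpan F (m + 1) t = frameSpan G m := by
  refine Submodule.eq_of_le_of_finrank_le (jetSpan_le_iff.2 h) ?_
  rw [jetSpan, finrank_span_eq_card hind, Fintype.card_fin]
  exact finrank_frameSpan_le hn G m

/-- If the connection form preserves a step of the flag, then the corresponding span of vectors of
the frame is constant. -/
lemma frameSpan_le_of_block (he : IsLorentzFrame I V e) (hI : UniqueDiffOn ℝ I)
    (hconv : Convex ℝ (I ∩ V)) {m : ℕ} (hm : 2 ≤ m)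
    (hblock : ∀ t ∈ I ∩ V, ∀ b c, flagIndex b ≤ m → m < flagIndex c →
      maurerCartan I e t c b = 0) {s t : ℝ} (hs : s ∈ I ∩ V) (ht : t ∈ I ∩ V) :
    frameSpan (e s) m ≤ frameSpan (e t) m := by
  -- Skew-symmetry exchanges the two off-diagonal blocks, because the step of the flag is stable
  -- under `flipIdx`.
  have hblock' : ∀ t ∈ I ∩ V, ∀ b c, flagIndex b ≤ m → m < flagIndex c →
      maurerCartan I e t b c = 0 := by
    intro t ht b c hb hc
    have h1 := he.maurerCartan_skew hI ht (flipIdx b) c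
    have h2 : maurerCartan I e t (flipIdx c) (flipIdx b) = 0 := by
      refine hblock t ht _ _ (flagIndex_flipIdx_le hm hb) ?_
      by_contra hcon
      have := flagIndex_flipIdx_le hm (not_lt.1 hcon)
      rw [flipIdx_flipIdx] at this
      omega
    rw [h2, flipIdx_flipIdx, mul_zero, add_zero] at h1
    exact (mul_eq_zero.1 h1).resolve_left (flipSign_ne_zero _)
  -- `d` is the diagonal of the projector D onto the positions ≤ m. Block diagonality of φ means
  -- that D commutes with φ.
  let d : Fin (n + 2) → ℝ := fun b => if flagIndex b ≤ m then 1 else 0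
  have hd : ∀ t ∈ I ∩ V, ∀ b c, (d c - d b) * maurerCartan I e t b c = 0 := by
    intro t ht b c
    by_cases h1 : flagIndex b ≤ m <;> by_cases h2 : flagIndex c ≤ m
    · simp [d, h1, h2]
    · rw [hblock' t ht b c h1 (not_le.1 h2), mul_zero]
    · rw [hblock t ht c b h2 (not_le.1 h1), mul_zero]
    · simp [d, h1, h2]
  -- y w = e D e⁻¹ w is the projection of the fixed vector w onto the span. Its derivative is e (φD
  -- - Dφ) e⁻¹ w = 0, so it is constant on the interval `I ∩ V`.
  let y : Coord n → ℝ → Coord n := fun w t => ∑ b, (d b * ((e t)⁻¹ *ᵥ w) b) • (e t).col b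
  have hy : ∀ w, ∀ t ∈ I ∩ V, HasDerivWithinAt (y w) 0 (I ∩ V) t := by
    intro w t ht
    have h1 := HasDerivWithinAt.fun_sum (u := Finset.univ) fun b _ =>
      ((he.hasDerivWithinAt_inv_mulVec hI ht (hasDerivWithinAt_const t I w) b).const_mul
        (d b)).smul (he.hasDerivWithinAt_col ht b)
    refine (h1.congr_deriv ?_).mono Set.inter_subset_left
    set x := (e t)⁻¹ *ᵥ w with hx
    simp only [he.colDeriv_eq_mulVec ht, mulVec_eq_sum_col (e t), mulVec_zero, Pi.zero_apply,
      zero_sub, Finset.sum_add_distrib, Finset.smul_sum]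
    rw [Finset.sum_comm, ← Finset.sum_add_distrib]
    refine Finset.sum_eq_zero fun b _ => ?_
    simp only [smul_smul]
    rw [← Finset.sum_smul, ← add_smul]
    suffices h2 : ∑ c, d c * x c * (maurerCartan I e t).col c b
        + d b * -(maurerCartan I e t *ᵥ x) b = 0 by rw [h2, zero_smul]
    rw [mulVec, dotProduct, ← Finset.sum_neg_distrib, Finset.mul_sum, ← Finset.sum_add_distrib]
    refine Finset.sum_eq_zero fun c _ => ?_
    rw [Matrix.col_apply]
    linear_combination x c * hd t ht b c
  intro v hv
  rw [mem_frameSpan (he.lorentz s hs)] at hv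
  have hconst : y v t = y v s := by
    have := hconv.norm_image_sub_le_of_norm_hasDerivWithin_le (C := 0) (hy v) (by simp) hs ht
    rw [zero_mul] at this
    exact sub_eq_zero.1 (norm_le_zero_iff.1 this)
  have hys : y v s = v := by
    have h1 : y v s = e s *ᵥ ((e s)⁻¹ *ᵥ v) := by
      rw [mulVec_eq_sum_col (e s)]
      refine Finset.sum_congr rfl fun b _ => ?_
      by_cases hb : flagIndex b ≤ m
      · simp [d, hb]
      · rw [hv b (not_le.1 hb)]; simp
    rw [h1, mulVec_mulVec, mul_inv_of_lorentz (he.lorentz s hs), one_mulVec]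
  rw [← hys, ← hconst]
  refine ⟨fun b => d b * ((e t)⁻¹ *ᵥ v) b, fun c hc => ?_, ?_⟩
  · simp [d, not_le.2 hc]
  · rw [mulVecLin_apply, mulVec_eq_sum_col]

end OsculatingSpaces

/-! ### The lift to the light cone with derivative of unit length. -/

section NormalLift

open Matrix

variable {n : ℕ} {I : Set ℝ} {t : ℝ} {f : ℝ → ProjSpace n} {F : ℕ → ℝ → Coord n}

/-- The product rule for a constant Lorentzian product. -/
lemma lip_deriv_of_eq_const (hI : UniqueDiffOn ℝ I) (ht : t ∈ I) {u v : ℝ → Coord n}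
    {u' v' : Coord n} (hu : HasDerivWithinAt u u' I t) (hv : HasDerivWithinAt v v' I t) {a : ℝ}
    (h : ∀ s ∈ I, lip n (u s) (v s) = a) : lip n u' (v t) + lip n (u t) v' = 0 :=
  (hI t ht).eq_deriv _ (hu.lip hv)
    ((hasDerivWithinAt_const t I a).congr (fun s hs => h s hs) (h t ht))

namespace IsNormalLift

lemma lip_zero_zero (hF : IsNormalLift I f F) (ht : t ∈ I) : lip n (F 0 t) (F 0 t) = 0 :=
  (mem_positiveCone.1 (hF.mem_cone t ht)).1

lemma lip_zero_one (hF : IsNormalLift I f F) (hI : UniqueDiffOn ℝ I) (ht : t ∈ I) :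
    lip n (F 0 t) (F 1 t) = 0 := by
  have h := lip_deriv_of_eq_const hI ht (hF.deriv 0 t ht) (hF.deriv 0 t ht)
    fun s hs => hF.lip_zero_zero hs
  rw [lip_comm (F (0 + 1) t), zero_add] at h
  linarith

lemma lip_zero_two (hF : IsNormalLift I f F) (hI : UniqueDiffOn ℝ I) (ht : t ∈ I) :
    lip n (F 0 t) (F 2 t) = -1 := by
  have h := lip_deriv_of_eq_const hI ht (hF.deriv 0 t ht) (hF.deriv 1 t ht)
    fun s hs => hF.lip_zero_one hI hs
  have h1 := hF.unit t ht
  norm_num at h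
  linarith

lemma lip_one_two (hF : IsNormalLift I f F) (hI : UniqueDiffOn ℝ I) (ht : t ∈ I) :
    lip n (F 1 t) (F 2 t) = 0 := by
  have h := lip_deriv_of_eq_const hI ht (hF.deriv 1 t ht) (hF.deriv 1 t ht)
    fun s hs => hF.unit s hs
  norm_num at h
  rw [lip_comm (F 2 t)] at h
  linarith

lemma zero_ne_zero (hF : IsNormalLift I f F) (ht : t ∈ I) : F 0 t ≠ 0 := by
  intro h
  have := (mem_positiveCone.1 (hF.mem_cone t ht)).2
  rw [h, map_zero] at this
  exact lt_irrefl _ this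

/-- Pairing a linear relation with F₀ kills the coefficient of F₂, and pairing with F₁ then kills
that of F₁. So no genericity is needed at this stage. -/
lemma jetIndependent_three (hF : IsNormalLift I f F) (hI : UniqueDiffOn ℝ I) (ht : t ∈ I) :
    JetIndependent F 3 t := by
  rw [JetIndependent, Fintype.linearIndependent_iff]
  intro g hg
  rw [Fin.sum_univ_three] at hg
  simp only [Fin.val_zero, Fin.val_one, Fin.val_two] at hg
  have h0 := congrArg (lip n (F 0 t)) hg
  have h1 := congrArg (lip n (F 1 t)) hg
  simp only [map_add, map_smul, map_zero, smul_eq_mul, hF.lip_zero_zero ht, hF.lip_zero_one hI ht,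
    hF.lip_zero_two hI ht] at h0
  simp only [map_add, map_smul, map_zero, smul_eq_mul, hF.lip_one_two hI ht,
    hF.unit t ht, lip_comm (F 1 t) (F 0 t), hF.lip_zero_one hI ht] at h1
  have g2 : g 2 = 0 := by linarith
  have g1 : g 1 = 0 := by linarith
  rw [g1, g2, zero_smul, zero_smul, add_zero, add_zero, smul_eq_zero] at hg
  have g0 := hg.resolve_right (hF.zero_ne_zero ht)
  intro i
  fin_cases i <;> assumption

end IsNormalLift

lemma represents_rep (x : ProjSpace n) : Represents x.rep x :=
  ⟨x.rep_nonzero, x.mk_rep⟩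

lemma Represents.lip_self_eq_zero {v : Coord n} {x : ProjSpace n} (h : Represents v x)
    (hx : x ∈ conformalSpace n) : lip n v v = 0 := by
  obtain ⟨a, -, rfl⟩ := (represents_iff_of_represents (represents_rep x)).1 h
  have : lip n x.rep x.rep = 0 := by rw [← lorentzForm_eq]; exact hx
  simp [this]

lemma contDiffOn_timeFn {U : Set ℝ} {u : ℝ → Coord n} (hu : ContDiffOn ℝ ∞ u U) :
    ContDiffOn ℝ ∞ (fun s => timeFn n (u s)) U := by
  rw [contDiffOn_pi] at hu
  exact (hu 0).add (hu _)

lemma uniqueDiffOn_of_ordConnected (hI : I.OrdConnected) (hI' : I.Nontrivial) :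
    UniqueDiffOn ℝ I := by
  refine uniqueDiffOn_convex hI.convex ?_
  obtain ⟨a, ha, b, hb, hab⟩ := hI'.exists_lt
  exact (Set.nonempty_Ioo.2 hab).mono
    (interior_maximal (Set.Ioo_subset_Icc_self.trans (hI.out ha hb)) isOpen_Ioo)

/-- A smooth immersion into the conformal sphere has a global lift to the light cone, which does
not move along the rulings. -/
lemma exists_lift_positiveCone (hI : UniqueDiffOn ℝ I) (hf : IsImmersedCurve I f) :
    ∃ G : ℝ → Coord n, ContDiffOn ℝ ∞ G I ∧ (∀ t ∈ I, G t ∈ positiveCone n) ∧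
      (∀ t ∈ I, Represents (G t) (f t)) ∧ ∀ t ∈ I, ∀ a : ℝ, derivWithin G I t ≠ a • G t := by
  -- The normalization `timeFn = 1` singles out one representative of each point. Hence the
  -- arbitrary choice of `rep` does no harm, and `G` agrees locally with a smooth lift divided by
  -- its time.
  let G : ℝ → Coord n := fun t => (timeFn n (f t).rep)⁻¹ • (f t).rep
  have hT : ∀ t ∈ I, ∀ v, Represents v (f t) → timeFn n v ≠ 0 := fun t ht v hv =>
    timeFn_ne_zero_of_null hv.1 (hv.lip_self_eq_zero (hf.1 t ht))
  have hG : ∀ t ∈ I, ∀ v, Represents v (f t) → v = timeFn n v • G t := by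
    intro t ht v hv
    obtain ⟨a, ha, rfl⟩ := (represents_iff_of_represents (represents_rep (f t))).1 hv
    have := hT t ht _ (represents_rep (f t))
    simp only [G, map_smul, smul_smul, smul_eq_mul]
    rw [mul_assoc, mul_inv_cancel₀ this, mul_one]
  have hrep : ∀ t ∈ I, Represents (G t) (f t) := fun t ht =>
    (represents_iff_of_represents (represents_rep (f t))).2
      ⟨_, inv_ne_zero (hT t ht _ (represents_rep (f t))), rfl⟩
  have hsm : ContDiffOn ℝ ∞ G I := by
    refine contDiffOn_of_locally_contDiffOn fun t ht => ?_
    obtain ⟨V, hV, htV, F, hF, hFf, -⟩ := hf.2 t ht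
    refine ⟨V, hV, htV, ?_⟩
    refine (((contDiffOn_timeFn hF).inv fun s hs => hT s hs.1 _ (hFf s hs)).smul hF).congr
      fun s hs => ?_
    have h1 := hG s hs.1 _ (hFf s hs)
    have h2 := hT s hs.1 _ (hFf s hs)
    change G s = (timeFn n (F s))⁻¹ • F s
    rw [eq_inv_smul_iff₀ h2]
    exact h1.symm
  refine ⟨G, hsm, fun t ht => mem_positiveCone.2
    ⟨(hrep t ht).lip_self_eq_zero (hf.1 t ht), ?_⟩, hrep, ?_⟩
  · have := hT t ht _ (represents_rep (f t))
    simp [G, this]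
  · intro t ht a ha
    obtain ⟨V, hV, htV, F, hF, hFf, hli⟩ := hf.2 t ht
    have h1 := hasDerivWithinAt_of_contDiffOn_inter hV (contDiffOn_timeFn hF) ⟨ht, htV⟩
    have h2 := ((hsm.differentiableOn (by simp)) t ht).hasDerivWithinAt
    have h3 := (h1.smul h2).congr_of_eventuallyEq (f₁ := F) (by
      filter_upwards [inter_mem_nhdsWithin I (hV.mem_nhds htV)] with s hs
      exact hG s hs.1 _ (hFf s hs)) (hG t ht _ (hFf t ⟨ht, htV⟩))
    rw [h3.derivWithin (hI t ht), ha] at hli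
    have h4 := hG t ht _ (hFf t ⟨ht, htV⟩)
    have h5 := hT t ht _ (hFf t ⟨ht, htV⟩)
    set τ := timeFn n (F t)
    set τ' := derivWithin (fun s => timeFn n (F s)) I t
    rw [LinearIndependent.pair_iff] at hli
    -- With F = τ G and G' = a G one has F' = (τ a + τ') G, whence the relation -(τ a + τ') F + τ F'
    -- = 0 with τ ≠ 0.
    have h6 := hli (-(τ * a + τ')) τ (by rw [h4]; module)
    exact h5 h6.2

/-- Since G is null and orthogonal to G', ⟨(kG)', (kG)'⟩ = k²⟨G', G'⟩. The derivative is spacelike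
because the curve does not move along the rulings of the cone, so k = ⟨G', G'⟩^{-1/2} is smooth and
normalizes the lift. -/
lemma exists_isNormalLift (hI : UniqueDiffOn ℝ I) (hf : IsImmersedCurve I f) :
    ∃ F : ℕ → ℝ → Coord n, IsNormalLift I f F := by
  obtain ⟨G, hsm, hcone, hrep, hne⟩ := exists_lift_positiveCone hI hf
  have hd : ∀ t ∈ I, HasDerivWithinAt G (derivWithin G I t) I t := fun t ht =>
    ((hsm.differentiableOn (by simp)) t ht).hasDerivWithinAt
  have hG0 : ∀ t ∈ I, lip n (G t) (G t) = 0 := fun t ht => (mem_positiveCone.1 (hcone t ht)).1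
  have hG1 : ∀ t ∈ I, lip n (G t) (derivWithin G I t) = 0 := by
    intro t ht
    have h := lip_deriv_of_eq_const hI ht (hd t ht) (hd t ht) hG0
    rw [lip_comm (derivWithin G I t)] at h
    linarith
  have hpos : ∀ t ∈ I, 0 < lip n (derivWithin G I t) (derivWithin G I t) := fun t ht =>
    lip_self_pos (hcone t ht) (hG1 t ht) (hne t ht)
  have hsm' : ContDiffOn ℝ ∞ (derivWithin G I) I := hsm.derivWithin hI (by simp)
  let k : ℝ → ℝ := fun t => (√(lip n (derivWithin G I t) (derivWithin G I t)))⁻¹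
  have hk : ContDiffOn ℝ ∞ k I := ((hsm'.lip hsm').sqrt fun t ht => (hpos t ht).ne').inv
    fun t ht => (Real.sqrt_pos.2 (hpos t ht)).ne'
  have hkpos : ∀ t ∈ I, 0 < k t := fun t ht => inv_pos.2 (Real.sqrt_pos.2 (hpos t ht))
  have h0 : ContDiffOn ℝ ∞ (fun t => k t • G t) I := hk.smul hsm
  have hs : ∀ i, ContDiffOn ℝ ∞ (iteratedDerivWithin i (fun t => k t • G t) I) I := by
    intro i
    induction i with
    | zero => rwa [iteratedDerivWithin_zero]
    | succ i ih => rw [iteratedDerivWithin_succ]; exact ih.derivWithin hI (by simp)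
  refine ⟨fun i => iteratedDerivWithin i (fun t => k t • G t) I, hs, ?_, ?_, ?_, ?_⟩
  · intro i t ht
    rw [iteratedDerivWithin_succ]
    exact (((hs i).differentiableOn (by simp)) t ht).hasDerivWithinAt
  · intro t ht
    rw [iteratedDerivWithin_zero, mem_positiveCone]
    simp only [map_smul, LinearMap.smul_apply, hG0 t ht, mul_zero, smul_eq_mul, true_and]
    exact mul_pos (hkpos t ht) (mem_positiveCone.1 (hcone t ht)).2
  · intro t ht
    rw [iteratedDerivWithin_zero]
    exact (represents_iff_of_represents (hrep t ht)).2 ⟨_, (hkpos t ht).ne', rfl⟩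
  · intro t ht
    rw [iteratedDerivWithin_one]
    have h1 := ((hk.differentiableOn (by simp)) t ht).hasDerivWithinAt.smul (hd t ht)
    have h2 : derivWithin (fun t => k t • G t) I t = _ := h1.derivWithin (hI t ht)
    rw [h2]
    have h3 : k t * k t * lip n (derivWithin G I t) (derivWithin G I t) = 1 := by
      have := hpos t ht
      simp only [k]
      rw [← mul_inv, Real.mul_self_sqrt this.le, inv_mul_cancel₀ this.ne']
    simp only [map_add, map_smul, LinearMap.add_apply, LinearMap.smul_apply, smul_eq_mul,
      hG0 t ht, hG1 t ht, lip_comm (derivWithin G I t) (G t)]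
    linear_combination h3

end NormalLift

/-! ### Gram-Schmidt orthogonalization in the spacelike complement of a null triad. -/

section GramSchmidt

open Matrix

variable {n : ℕ} {U : Set ℝ} {t : ℝ} {u : Fin 3 → ℝ → Coord n} {Z : ℕ → ℝ → Coord n}

/-- Three vector functions with the products of `η₀, η₁, ηₙ₊₁`, the first of them in the light
cone. -/
structure IsNullTriad (u : Fin 3 → ℝ → Coord n) (U : Set ℝ) : Prop where
  smooth : ∀ i, ContDiffOn ℝ ∞ (u i) U
  mem_cone : ∀ t ∈ U, u 0 t ∈ positiveCone n
  lip_zero_one : ∀ t ∈ U, lip n (u 0 t) (u 1 t) = 0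
  lip_zero_two : ∀ t ∈ U, lip n (u 0 t) (u 2 t) = -1
  lip_one_one : ∀ t ∈ U, lip n (u 1 t) (u 1 t) = 1
  lip_one_two : ∀ t ∈ U, lip n (u 1 t) (u 2 t) = 0
  lip_two_two : ∀ t ∈ U, lip n (u 2 t) (u 2 t) = 0

/-- The component of `v` in the orthogonal complement of a null triad. -/
noncomputable def triadNormal (u : Fin 3 → ℝ → Coord n) (v : Coord n) (t : ℝ) : Coord n :=
  v + lip n v (u 2 t) • u 0 t + lip n v (u 0 t) • u 2 t - lip n v (u 1 t) • u 1 t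

/-- The Gram-Schmidt process in the orthogonal complement of a null triad, for the sequence
`Z 3, Z 4, …`. -/
noncomputable def triadGramSchmidt (u : Fin 3 → ℝ → Coord n) (Z : ℕ → ℝ → Coord n) :
    ℕ → ℝ → Coord n
  | m, t =>
    let z := triadNormal u (Z (m + 3) t) t - ∑ l : Fin m,
      lip n (Z (m + 3) t) (triadGramSchmidt u Z l t) • triadGramSchmidt u Z l t
    (√(lip n z z))⁻¹ • z
termination_by m => m
decreasing_by all_goals exact l.2

/-- The vector which is normalized in the Gram-Schmidt process. -/
noncomputable def triadResidue (u : Fin 3 → ℝ → Coord n) (Z : ℕ → ℝ → Coord n) (m : ℕ) (t : ℝ) :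
    Coord n :=
  triadNormal u (Z (m + 3) t) t - ∑ l : Fin m,
    lip n (Z (m + 3) t) (triadGramSchmidt u Z l t) • triadGramSchmidt u Z l t

lemma triadGramSchmidt_eq (u : Fin 3 → ℝ → Coord n) (Z : ℕ → ℝ → Coord n) (m : ℕ) (t : ℝ) :
    triadGramSchmidt u Z m t =
      (√(lip n (triadResidue u Z m t) (triadResidue u Z m t)))⁻¹ • triadResidue u Z m t := by
  rw [triadGramSchmidt]; rfl

namespace IsNullTriad

lemma lip_triadNormal (hu : IsNullTriad u U) (ht : t ∈ U) (v : Coord n) (i : Fin 3) :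
    lip n (u i t) (triadNormal u v t) = 0 := by
  have h00 := (mem_positiveCone.1 (hu.mem_cone t ht)).1
  fin_cases i <;> simp only [Fin.zero_eta, Fin.mk_one, Fin.reduceFinMk, triadNormal, map_add,
    map_sub, map_smul, smul_eq_mul, h00, hu.lip_zero_one t ht, hu.lip_zero_two t ht,
    hu.lip_one_one t ht, hu.lip_one_two t ht, hu.lip_two_two t ht, lip_comm (u 1 t) (u 0 t),
    lip_comm (u 2 t) (u 0 t), lip_comm (u 2 t) (u 1 t), lip_comm (u _ t) v] <;> ring

/-- The properties of the Gram-Schmidt process. -/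
lemma gramSchmidt_spec (hu : IsNullTriad u U) (hZ : ∀ i, ContDiffOn ℝ ∞ (Z i) U)
    (huZ : ∀ t ∈ U, ∀ i, u i t ∈ jetSpan Z 3 t) {M : ℕ}
    (hind : ∀ t ∈ U, JetIndependent Z (M + 3) t) : ∀ m < M,
    ContDiffOn ℝ ∞ (triadGramSchmidt u Z m) U ∧ ∀ t ∈ U,
      0 < lip n (triadResidue u Z m t) (triadResidue u Z m t) ∧
      (∀ i, lip n (u i t) (triadGramSchmidt u Z m t) = 0) ∧
      (∀ l < m, lip n (triadGramSchmidt u Z l t) (triadGramSchmidt u Z m t) = 0) ∧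
      lip n (triadGramSchmidt u Z m t) (triadGramSchmidt u Z m t) = 1 ∧
      triadGramSchmidt u Z m t ∈ jetSpan Z (m + 4) t := by
  intro m
  induction m using Nat.strong_induction_on with
  | h m ih =>
  intro hm
  have hmono : ∀ t {a b : ℕ}, a ≤ b → jetSpan Z a t ≤ jetSpan Z b t := fun t a b hab =>
    jetSpan_le_iff.2 fun i hi => mem_jetSpan (by omega)
  have hsum : ∀ t ∈ U, triadResidue u Z m t - Z (m + 3) t ∈ jetSpan Z (m + 3) t := by
    intro t ht
    have hu' : ∀ i, u i t ∈ jetSpan Z (m + 3) t := fun i => hmono t (by omega) (huZ t ht i)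
    have : triadResidue u Z m t - Z (m + 3) t = lip n (Z (m + 3) t) (u 2 t) • u 0 t
        + lip n (Z (m + 3) t) (u 0 t) • u 2 t - lip n (Z (m + 3) t) (u 1 t) • u 1 t
        - ∑ l : Fin m, lip n (Z (m + 3) t) (triadGramSchmidt u Z l t) •
          triadGramSchmidt u Z l t := by
      rw [triadResidue, triadNormal]; abel
    rw [this]
    refine Submodule.sub_mem _ (Submodule.sub_mem _ (Submodule.add_mem _ ?_ ?_) ?_)
      (Submodule.sum_mem _ fun l _ => ?_)
    · exact Submodule.smul_mem _ _ (hu' _)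
    · exact Submodule.smul_mem _ _ (hu' _)
    · exact Submodule.smul_mem _ _ (hu' _)
    exact Submodule.smul_mem _ _
      (hmono t (by omega) ((ih l l.2 (by omega)).2 t ht).2.2.2.2)
  have hmem : ∀ t ∈ U, triadResidue u Z m t ∈ jetSpan Z (m + 4) t := by
    intro t ht
    have := Submodule.add_mem _ (hmono t (show m + 3 ≤ m + 4 by omega) (hsum t ht))
      (mem_jetSpan (F := Z) (t := t) (show m + 3 < m + 4 by omega))
    rwa [sub_add_cancel] at this
  have horth : ∀ t ∈ U, ∀ i, lip n (u i t) (triadResidue u Z m t) = 0 := by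
    intro t ht i
    rw [triadResidue, map_sub, hu.lip_triadNormal ht, map_sum, zero_sub, neg_eq_zero]
    refine Finset.sum_eq_zero fun l _ => ?_
    rw [map_smul, ((ih l l.2 (by omega)).2 t ht).2.1 i, smul_zero]
  have horth' : ∀ t ∈ U, ∀ l < m,
      lip n (triadGramSchmidt u Z l t) (triadResidue u Z m t) = 0 := by
    intro t ht l hl
    have hl' := (ih l hl (by omega)).2 t ht
    have hul : ∀ i, lip n (triadGramSchmidt u Z l t) (u i t) = 0 := fun i => by
      rw [lip_comm, hl'.2.1 i]
    rw [triadResidue, map_sub, map_sum, Finset.sum_eq_single (⟨l, hl⟩ : Fin m)]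
    · simp only [map_smul, hl'.2.2.2.1, triadNormal, map_add, map_sub, hul, smul_eq_mul]
      rw [lip_comm _ (Z (m + 3) t)]; ring
    · intro l' _ hne
      rw [map_smul]
      have hne' : (l' : ℕ) ≠ l := fun h => hne (Fin.ext h)
      rcases lt_or_gt_of_ne hne' with h | h
      · rw [lip_comm (triadGramSchmidt u Z l t), hl'.2.2.1 l' h, smul_zero]
      · rw [((ih l' l'.2 (by omega)).2 t ht).2.2.1 l h, smul_zero]
    · simp
  have hpos : ∀ t ∈ U, 0 < lip n (triadResidue u Z m t) (triadResidue u Z m t) := by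
    intro t ht
    -- The residue is orthogonal to the null vector u₀, so its square is positive unless it is a
    -- multiple of u₀. That would put Z_{m+3} into the span of its predecessors.
    refine lip_self_pos (hu.mem_cone t ht) (horth t ht 0) fun a ha => ?_
    have h1 := hsum t ht
    rw [ha] at h1
    have h2 := Submodule.sub_mem _ (Submodule.smul_mem _ a
      (hmono t (show 3 ≤ m + 3 by omega) (huZ t ht 0))) h1
    rw [sub_sub_cancel] at h2
    exact (jetIndependent_succ_iff.1 ((hind t ht).of_le (show m + 3 + 1 ≤ M + 3 by omega))).2 h2
  have hres : ContDiffOn ℝ ∞ (triadResidue u Z m) U := by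
    have hz := hZ (m + 3)
    have h1 : ContDiffOn ℝ ∞ (fun t => triadNormal u (Z (m + 3) t) t) U :=
      ((hz.add ((hz.lip (hu.smooth 2)).smul (hu.smooth 0))).add
        ((hz.lip (hu.smooth 0)).smul (hu.smooth 2))).sub
          ((hz.lip (hu.smooth 1)).smul (hu.smooth 1))
    refine h1.sub (ContDiffOn.sum fun l _ => ?_)
    have h2 := (ih l l.2 (by omega)).1
    exact (hz.lip h2).smul h2
  refine ⟨?_, fun t ht => ⟨hpos t ht, ?_, ?_, ?_, ?_⟩⟩
  · refine ContDiffOn.congr ?_ fun t _ => triadGramSchmidt_eq u Z m t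
    exact (((hres.lip hres).sqrt fun t ht => (hpos t ht).ne').inv
      fun t ht => (Real.sqrt_pos.2 (hpos t ht)).ne').smul hres
  · intro i
    rw [triadGramSchmidt_eq, map_smul, horth t ht, smul_zero]
  · intro l hl
    rw [triadGramSchmidt_eq u Z m, map_smul, horth' t ht l hl, smul_zero]
  · rw [triadGramSchmidt_eq]
    simp only [map_smul, LinearMap.smul_apply, smul_eq_mul]
    have := hpos t ht
    have h1 := Real.mul_self_sqrt this.le
    have h2 := (Real.sqrt_pos.2 this).ne'
    field_simp
    linarith
  · rw [triadGramSchmidt_eq]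
    exact Submodule.smul_mem _ _ (hmem t ht)

/-- The new vector is orthogonal to everything subtracted from Z_{m+3}, so its product with Z_{m+3}
is the length of the residue. For m = 0 the positivity of this number allows the square root that
fixes the scale of the frame. -/
lemma lip_gramSchmidt_self_pos (hu : IsNullTriad u U) (hZ : ∀ i, ContDiffOn ℝ ∞ (Z i) U)
    (huZ : ∀ t ∈ U, ∀ i, u i t ∈ jetSpan Z 3 t) {M : ℕ}
    (hind : ∀ t ∈ U, JetIndependent Z (M + 3) t) (ht : t ∈ U) {m : ℕ} (hm : m < M) :
    triadResidue u Z m t = √(lip n (triadResidue u Z m t) (triadResidue u Z m t)) •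
      triadGramSchmidt u Z m t ∧
    lip n (Z (m + 3) t) (triadGramSchmidt u Z m t) =
      √(lip n (triadResidue u Z m t) (triadResidue u Z m t)) ∧
    0 < √(lip n (triadResidue u Z m t) (triadResidue u Z m t)) := by
  obtain ⟨hpos, h1, h2, h3, -⟩ := (hu.gramSchmidt_spec hZ huZ hind m hm).2 t ht
  have hs := Real.sqrt_pos.2 hpos
  have e1 : triadResidue u Z m t = √(lip n (triadResidue u Z m t) (triadResidue u Z m t)) •
      triadGramSchmidt u Z m t := by
    rw [triadGramSchmidt_eq, smul_smul, mul_inv_cancel₀ hs.ne', one_smul]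
  refine ⟨e1, ?_, hs⟩
  have e2 := congrArg (lip n (triadGramSchmidt u Z m t)) e1
  rw [map_smul, h3, smul_eq_mul, mul_one] at e2
  rw [← e2, triadResidue, map_sub, map_sum, Finset.sum_eq_zero, sub_zero]
  · have hul : ∀ i, lip n (triadGramSchmidt u Z m t) (u i t) = 0 := fun i => by
      rw [lip_comm, h1 i]
    simp only [triadNormal, map_add, map_sub, map_smul, hul, smul_zero, add_zero, sub_zero]
    exact lip_comm _ _
  · intro l _
    rw [map_smul, lip_comm (triadGramSchmidt u Z m t), h2 l l.2, smul_zero]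

/-- The vectors of the process are orthogonal to the earlier vectors of the sequence. -/
lemma lip_gramSchmidt_eq_zero (hu : IsNullTriad u U) (hZ : ∀ i, ContDiffOn ℝ ∞ (Z i) U)
    (huZ : ∀ t ∈ U, ∀ i, u i t ∈ jetSpan Z 3 t)
    (hZu : ∀ t ∈ U, ∀ i < 3, ∀ W : Submodule ℝ (Coord n), (∀ j, u j t ∈ W) → Z i t ∈ W) {M : ℕ}
    (hind : ∀ t ∈ U, JetIndependent Z (M + 3) t) (ht : t ∈ U) {m : ℕ} (hm : m < M) {j : ℕ}
    (hj : j < m + 3) : lip n (Z j t) (triadGramSchmidt u Z m t) = 0 := by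
  obtain ⟨-, h1, h2, -, -⟩ := (hu.gramSchmidt_spec hZ huZ hind m hm).2 t ht
  -- `W` is the hyperplane orthogonal to the m-th vector. It contains the triad and the earlier
  -- vectors of the process, from which every earlier Zⱼ is recovered.
  let W : Submodule ℝ (Coord n) := LinearMap.ker ((lip n).flip (triadGramSchmidt u Z m t))
  have hW : ∀ v, v ∈ W ↔ lip n v (triadGramSchmidt u Z m t) = 0 := fun v => Iff.rfl
  rw [← hW]
  rcases Nat.lt_or_ge j 3 with h3 | h3
  · exact hZu t ht j h3 W h1
  obtain ⟨l, rfl⟩ := Nat.exists_eq_add_of_le' h3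
  have hl : l < m := by omega
  have e1 := (hu.lip_gramSchmidt_self_pos hZ huZ hind ht (show l < M by omega)).1
  have e2 : triadResidue u Z l t ∈ W := by
    rw [e1]; exact W.smul_mem _ (h2 l hl)
  have e3 : Z (l + 3) t = triadResidue u Z l t + (∑ l' : Fin l,
      lip n (Z (l + 3) t) (triadGramSchmidt u Z l' t) • triadGramSchmidt u Z l' t)
      - lip n (Z (l + 3) t) (u 2 t) • u 0 t - lip n (Z (l + 3) t) (u 0 t) • u 2 t
      + lip n (Z (l + 3) t) (u 1 t) • u 1 t := by
    rw [triadResidue, triadNormal]; abel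
  rw [e3]
  refine W.add_mem (W.sub_mem (W.sub_mem (W.add_mem e2 (W.sum_mem fun l' _ => ?_)) ?_) ?_) ?_
  · exact W.smul_mem _ (h2 l' (by omega))
  · exact W.smul_mem _ (h1 _)
  · exact W.smul_mem _ (h1 _)
  · exact W.smul_mem _ (h1 _)

end IsNullTriad

end GramSchmidt

/-! ### Completion to a basis, orientation, and frames adapted to the normal lift. -/

section AdaptedFrames

open Matrix

variable {n : ℕ} {I V : Set ℝ} {t q : ℝ} {f : ℝ → ProjSpace n} {F N : ℕ → ℝ → Coord n}
  {r y : ℝ → ℝ}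

/-- Independent vectors are completed to a basis by constant vectors. -/
lemma exists_jetIndependent_extension {m : ℕ} (h : JetIndependent F m q) {M : ℕ} (hm : m ≤ M)
    (hM : M ≤ n + 2) :
    ∃ c : ℕ → Coord n, JetIndependent (fun i t => if i < m then F i t else c i) M q := by
  induction M, hm using Nat.le_induction with
  | base =>
    refine ⟨0, ?_⟩
    unfold JetIndependent at h ⊢
    simpa using h
  | succ M hm ih =>
    obtain ⟨c, hc⟩ := ih (by omega)
    obtain ⟨x, hx⟩ : ∃ x, x ∉ jetSpan (fun i t => if i < m then F i t else c i) M q := by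
      by_contra! hcon
      have h1 := finrank_span_eq_card (b := fun i : Fin M => if (i : ℕ) < m then F i q else c i) hc
      have h2 : Submodule.span ℝ (Set.range fun i : Fin M => if (i : ℕ) < m then F i q else c i)
        = ⊤ := Submodule.eq_top_iff'.2 hcon
      rw [h2, finrank_top, Module.finrank_fin_fun, Fintype.card_fin] at h1
      omega
    refine ⟨Function.update c M x, jetIndependent_succ_iff.2 ?_⟩
    have h3 : (fun i : Fin M => if (i : ℕ) < m then F i q else Function.update c M x i)
        = fun i : Fin M => if (i : ℕ) < m then F i q else c i := by
      ext1 i; rw [Function.update_of_ne i.2.ne]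
    refine ⟨by unfold JetIndependent at hc ⊢; rw [h3]; exact hc, ?_⟩
    unfold jetSpan at hx ⊢
    rw [h3]
    simpa [not_lt.2 hm] using hx

/-- For n + 2 vectors independence is the nonvanishing of a determinant, which is continuous along
`I`. -/
lemma exists_isOpen_jetIndependent {Z : ℕ → ℝ → Coord n} (hZ : ∀ i, ContDiffOn ℝ ∞ (Z i) I)
    (hq : q ∈ I) (h : JetIndependent Z (n + 2) q) :
    ∃ V, IsOpen V ∧ q ∈ V ∧ ∀ t ∈ I ∩ V, JetIndependent Z (n + 2) t := by
  let A : ℝ → Matrix (Fin (n + 2)) (Fin (n + 2)) ℝ := fun t => Matrix.of fun i => Z i t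
  have hA : ∀ t, JetIndependent Z (n + 2) t ↔ (A t).det ≠ 0 := by
    intro t
    rw [← isUnit_iff_ne_zero, ← Matrix.isUnit_iff_isUnit_det,
      ← Matrix.linearIndependent_rows_iff_isUnit]
    rfl
  have hc : ContinuousWithinAt (fun t => (A t).det) I q := by
    refine (continuous_id.matrix_det.continuousAt).comp_continuousWithinAt ?_
    exact continuousWithinAt_pi.2 fun i => (hZ i).continuousOn q hq
  have h1 := hc.eventually_ne ((hA q).1 h)
  obtain ⟨V, hV, hqV, hsub⟩ := mem_nhdsWithin.1 h1
  exact ⟨V, hV, hqV, fun t ht => (hA t).2 (hsub ⟨ht.2, ht.1⟩)⟩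

lemma contDiffOn_det {U : Set ℝ} {A : ℝ → Matrix (Fin (n + 2)) (Fin (n + 2)) ℝ}
    (hA : ∀ i j, ContDiffOn ℝ ∞ (fun t => A t i j) U) :
    ContDiffOn ℝ ∞ (fun t => (A t).det) U := by
  simp only [det_apply']
  exact ContDiffOn.sum fun σ _ => contDiffOn_const.mul (contDiffOn_prod fun i _ => hA _ _)

lemma det_mul_self_of_lorentz {G : Matrix (Fin (n + 2)) (Fin (n + 2)) ℝ}
    (hG : Gᵀ * lorentzMatrix n * G = lorentzMatrix n) : G.det * G.det = 1 := by
  have h1 := congrArg det hG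
  have h2 := congrArg det (lorentzMatrix_mul_self (n := n))
  rw [det_mul, det_mul, det_transpose] at h1
  rw [det_mul, det_one] at h2
  have h3 : (lorentzMatrix n).det ≠ 0 := left_ne_zero_of_mul_eq_one h2
  have : (G.det * G.det) * (lorentzMatrix n).det = 1 * (lorentzMatrix n).det := by
    linear_combination h1
  exact mul_right_cancel₀ h3 this

/-- The factors by which the columns of a Lorentz matrix are multiplied to make its determinant
equal to one. -/
noncomputable def orientationFactor (G : Matrix (Fin (n + 2)) (Fin (n + 2)) ℝ) (b : Fin (n + 2)) :
    ℝ := if b.val = n then G.det else 1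

/-- The Lorentz matrix of determinant one obtained by a change of sign of the column `n`. -/
noncomputable def oriented (G : Matrix (Fin (n + 2)) (Fin (n + 2)) ℝ) :
    Matrix (Fin (n + 2)) (Fin (n + 2)) ℝ := G * diagonal (orientationFactor G)

lemma oriented_apply (G : Matrix (Fin (n + 2)) (Fin (n + 2)) ℝ) (i b : Fin (n + 2)) :
    oriented G i b = G i b * orientationFactor G b := mul_diagonal _ _ _ _

lemma oriented_col (G : Matrix (Fin (n + 2)) (Fin (n + 2)) ℝ) (b : Fin (n + 2)) :
    (oriented G).col b = orientationFactor G b • G.col b := by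
  ext i; rw [Matrix.col_apply, oriented_apply, mul_comm]; rfl

lemma oriented_col_of_ne (G : Matrix (Fin (n + 2)) (Fin (n + 2)) ℝ) {b : Fin (n + 2)}
    (hb : b.val ≠ n) : (oriented G).col b = G.col b := by
  rw [oriented_col, orientationFactor, if_neg hb, one_smul]

lemma oriented_lorentz (hn : 1 ≤ n) {G : Matrix (Fin (n + 2)) (Fin (n + 2)) ℝ}
    (hG : Gᵀ * lorentzMatrix n * G = lorentzMatrix n) :
    (oriented G)ᵀ * lorentzMatrix n * oriented G = lorentzMatrix n := by
  rw [lorentz_iff_lip_col] at hG ⊢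
  intro i j
  rw [oriented_col, oriented_col, map_smul, map_smul, LinearMap.smul_apply, hG, smul_eq_mul,
    smul_eq_mul, lorentzMatrix_apply]
  split_ifs with h
  · subst h
    have h1 := det_mul_self_of_lorentz (lorentz_iff_lip_col.2 hG)
    by_cases hi : i.val = n
    · rw [flipIdx_of_ne (by rintro rfl; simp at hi; omega) (by rintro rfl; simp at hi)]
      rw [orientationFactor, if_pos hi, ← mul_assoc, h1, one_mul]
    · have h2 : (flipIdx i).val ≠ n := by
        by_cases h0 : i = 0
        · subst h0; simp
        by_cases h1 : i = Fin.last (n + 1)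
        · subst h1; simp; omega
        rwa [flipIdx_of_ne h0 h1]
      rw [orientationFactor, orientationFactor, if_neg hi, if_neg h2, one_mul, one_mul]
  · simp

lemma oriented_det {G : Matrix (Fin (n + 2)) (Fin (n + 2)) ℝ}
    (hG : Gᵀ * lorentzMatrix n * G = lorentzMatrix n) : (oriented G).det = 1 := by
  have h : ∏ b, orientationFactor G b = G.det := by
    rw [Finset.prod_eq_single (⟨n, by omega⟩ : Fin (n + 2))]
    · simp [orientationFactor]
    · intro b _ hb
      rw [orientationFactor, if_neg fun h => hb (Fin.ext h)]
    · simp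
  rw [oriented, det_mul, det_diagonal, h, det_mul_self_of_lorentz hG]

/-- A frame whose vectors at the positions `≥ j + 1` are orthogonal to the first derivatives of the
lift satisfies the higher order conditions. -/
lemma isHessenberg_of_mem_flagSpace (hn : 1 ≤ n)
    {e : ℝ → Matrix (Fin (n + 2)) (Fin (n + 2)) ℝ} (he : IsLorentzFrame I V e)
    (hI : UniqueDiffOn ℝ I) (hF : IsNormalLift I f F) {m : ℕ}
    (hmem : ∀ j ≤ m + 1, ∀ t ∈ I ∩ V, (e t)⁻¹ *ᵥ F j t ∈ flagSpace n j)
    (hind : ∀ t ∈ I ∩ V, JetIndependent F (m + 1) t) (ht : t ∈ I ∩ V) :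
    IsHessenberg m (maurerCartan I e t) := by
  have hinv : ∀ v : Coord n, e t *ᵥ ((e t)⁻¹ *ᵥ v) = v := fun v => by
    rw [mulVec_mulVec, mul_inv_of_lorentz (he.lorentz t ht), one_mulVec]
  suffices h : ∀ j ≤ m, ∀ b c, flagIndex b = j → j + 1 < flagIndex c →
      maurerCartan I e t c b = 0 from fun b c hb hc => h _ hb b c rfl hc
  -- Induction over the columns: the component c of xⱼ₊₁ = xⱼ' + φ xⱼ reduces to φ^c_b times the
  -- leading component of Fⱼ, since the earlier columns are already known to vanish there. The
  -- leading component is nonzero because F₀ ≠ 0 for j = 0, and by independence for j > 0.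
  intro j
  induction j using Nat.strong_induction_on with
  | h j ih =>
  intro hj b c hb hc
  have h1 := he.inv_mulVec_deriv_apply hI ht (hF.deriv j t ht.1)
    (fun s hs => hmem j (by omega) s hs c (by omega))
  rw [hmem (j + 1) (by omega) t ht c hc, mulVec, dotProduct,
    Finset.sum_eq_single b (fun b' _ hbb => ?_) (by simp)] at h1
  · refine (mul_eq_zero.1 h1.symm).resolve_right ?_
    rcases j with _ | j
    · intro h0
      refine hF.zero_ne_zero ht.1 ?_
      rw [← hinv (F 0 t)]
      have : (e t)⁻¹ *ᵥ F 0 t = 0 := by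
        ext d
        rcases eq_or_ne d b with rfl | hd
        · exact h0
        · refine hmem 0 (by omega) t ht d (Nat.pos_of_ne_zero fun h => hd ?_)
          exact flagIndex_injective hn (h.trans hb.symm)
      rw [this, mulVec_zero]
    · exact diag_ne_zero_of_mem_flagSpace hn (he.lorentz t ht)
        (fun i hi => hmem i (by omega) t ht) ((hind t ht).of_le (by omega)) hb
  · have hne : flagIndex b' ≠ j := fun h => hbb (flagIndex_injective hn (h.trans hb.symm))
    rcases Nat.lt_or_ge j (flagIndex b') with h2 | h2
    · rw [hmem j (by omega) t ht b' h2, mul_zero]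
    · rw [ih (flagIndex b') (by omega) (by omega) b' c rfl (by omega), zero_mul]

/-- The columns of the frame built from the normal lift, the functions `r`, `y` of a change of
scale and the normal vectors `N`. -/
noncomputable def adaptedColumn (F N : ℕ → ℝ → Coord n) (r y : ℝ → ℝ) (b : Fin (n + 2)) (t : ℝ) :
    Coord n :=
  if b = 0 then r t • F 0 t
  else if b = Fin.last (n + 1) then
    (r t)⁻¹ • (F 2 t + y t • F 1 t + ((lip n (F 2 t) (F 2 t) + y t * y t) / 2) • F 0 t)
  else if b.val = 1 then F 1 t + y t • F 0 t
  else N (b.val - 2) t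

/-- The matrix with the columns `adaptedColumn`. -/
noncomputable def adaptedMatrix (F N : ℕ → ℝ → Coord n) (r y : ℝ → ℝ) (t : ℝ) :
    Matrix (Fin (n + 2)) (Fin (n + 2)) ℝ := Matrix.of fun i b => adaptedColumn F N r y b t i

lemma adaptedColumn_zero : adaptedColumn F N r y 0 t = r t • F 0 t := by simp [adaptedColumn]

lemma adaptedColumn_last : adaptedColumn F N r y (Fin.last (n + 1)) t =
    (r t)⁻¹ • (F 2 t + y t • F 1 t + ((lip n (F 2 t) (F 2 t) + y t * y t) / 2) • F 0 t) := by
  simp [adaptedColumn]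

lemma adaptedColumn_one (hn : 1 ≤ n) {b : Fin (n + 2)} (hb : b.val = 1) :
    adaptedColumn F N r y b t = F 1 t + y t • F 0 t := by
  rw [adaptedColumn, if_neg (by rintro rfl; simp at hb),
    if_neg (by rintro rfl; simp at hb; omega), if_pos hb]

lemma adaptedColumn_normal {b : Fin (n + 2)} (hb : 2 ≤ b.val) (hb' : b.val ≤ n) :
    adaptedColumn F N r y b t = N (b.val - 2) t := by
  rw [adaptedColumn, if_neg (by rintro rfl; simp at hb),
    if_neg (by rintro rfl; simp at hb'), if_neg (by omega)]

lemma adaptedMatrix_col (b : Fin (n + 2)) :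
    (adaptedMatrix F N r y t).col b = adaptedColumn F N r y b t := rfl

/-- The coefficient (⟨F₂, F₂⟩ + y²)/2 in the last column makes it null, and y F₁ makes it orthogonal
to F₁ + y F₀. The factors r and r⁻¹ cancel in ⟨e₀, eₙ₊₁⟩ = -1. -/
lemma adaptedMatrix_lorentz (hn : 1 ≤ n) (hI : UniqueDiffOn ℝ I) (hF : IsNormalLift I f F)
    (ht : t ∈ I) (hr : r t ≠ 0) (hFN : ∀ m < n - 1, ∀ j < 3, lip n (F j t) (N m t) = 0)
    (hN : ∀ m < n - 1, ∀ l < n - 1, lip n (N m t) (N l t) = if m = l then 1 else 0) :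
    (adaptedMatrix F N r y t)ᵀ * lorentzMatrix n * adaptedMatrix F N r y t = lorentzMatrix n := by
  have h00 := hF.lip_zero_zero ht
  have h01 := hF.lip_zero_one hI ht
  have h02 := hF.lip_zero_two hI ht
  have h11 := hF.unit t ht
  have h12 := hF.lip_one_two hI ht
  have h10 := (lip_comm (F 1 t) (F 0 t)).trans h01
  have h20 := (lip_comm (F 2 t) (F 0 t)).trans h02
  have h21 := (lip_comm (F 2 t) (F 1 t)).trans h12
  have hcase : ∀ i j : Fin (n + 2), flagIndex i ≤ flagIndex j →
      lip n (adaptedColumn F N r y i t) (adaptedColumn F N r y j t) = lorentzMatrix n i j := by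
    intro i j hij
    have hmid : 1 ≤ i.val → i.val ≤ n → lorentzMatrix n i j = if j = i then 1 else 0 := by
      intro h1 h2
      have hi0 : i ≠ 0 := by rintro rfl; simp at h1
      have hi1 : i ≠ Fin.last (n + 1) := by rintro rfl; simp at h2
      rw [lorentzMatrix_apply, flipIdx_of_ne hi0 hi1, flipSign_of_ne hi0 hi1]
    have hS0 : i = 0 → lorentzMatrix n i j = if j = Fin.last (n + 1) then -1 else 0 := by
      rintro rfl; rw [lorentzMatrix_apply, flipIdx_zero]; simp [flipSign]
    have hSl : i = Fin.last (n + 1) → lorentzMatrix n i j = if j = 0 then -1 else 0 := by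
      rintro rfl; rw [lorentzMatrix_apply, flipIdx_last]; simp [flipSign]
    rcases flagIndex_cases hn i with ⟨l1, l2⟩ | ⟨l1, l2⟩ | ⟨l1, l2⟩ | ⟨l1, l2, l3⟩ <;>
    rcases flagIndex_cases hn j with ⟨k1, k2⟩ | ⟨k1, k2⟩ | ⟨k1, k2⟩ | ⟨k1, k2, k3⟩ <;>
    rw [l1, k1] at hij <;> try omega
    · rw [hS0 l2, l2, k2, adaptedColumn_zero]; simp [h00, Fin.ext_iff]
    · rw [hS0 l2, l2, adaptedColumn_zero, adaptedColumn_one hn k2,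
        if_neg (by rintro rfl; simp at k2; omega)]
      simp [h00, h01]
    · rw [hS0 l2, l2, k2, adaptedColumn_zero, adaptedColumn_last, if_pos rfl]
      simp [h00, h01, h02, hr]
    · rw [hS0 l2, l2, adaptedColumn_zero, adaptedColumn_normal k2 k3,
        if_neg (by rintro rfl; simp at k3)]
      simp [hFN _ (show j.val - 2 < n - 1 by omega) 0 (by omega)]
    · rw [hmid (by omega) (by omega), adaptedColumn_one hn l2, adaptedColumn_one hn k2,
        if_pos (Fin.ext (by omega))]
      simp [h00, h01, h11, h10]
    · rw [hmid (by omega) (by omega), adaptedColumn_one hn l2, k2, adaptedColumn_last,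
        if_neg (by rintro rfl; simp at l2; omega)]
      simp [h00, h01, h11, h10, h12, h02]
      ring
    · rw [hmid (by omega) (by omega), adaptedColumn_one hn l2, adaptedColumn_normal k2 k3,
        if_neg (by rintro rfl; omega)]
      simp [hFN _ (show j.val - 2 < n - 1 by omega) 0 (by omega),
        hFN _ (show j.val - 2 < n - 1 by omega) 1 (by omega)]
    · rw [hSl l2, l2, k2, adaptedColumn_last, if_neg (by simp [Fin.ext_iff])]
      simp [h00, h01, h11, h10, h12, h02, h20, h21]
      ring
    · rw [hSl l2, l2, adaptedColumn_last, adaptedColumn_normal k2 k3,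
        if_neg (by rintro rfl; simp at k2)]
      simp [hFN _ (show j.val - 2 < n - 1 by omega) 0 (by omega),
        hFN _ (show j.val - 2 < n - 1 by omega) 1 (by omega),
        hFN _ (show j.val - 2 < n - 1 by omega) 2 (by omega)]
    · rw [hmid (by omega) (by omega), adaptedColumn_normal l2 l3, adaptedColumn_normal k2 k3,
        hN _ (by omega) _ (by omega)]
      congr 1
      simp only [Fin.ext_iff, eq_iff_iff]
      omega
  rw [lorentz_iff_lip_col]
  intro i j
  rw [adaptedMatrix_col, adaptedMatrix_col]
  rcases le_total (flagIndex i) (flagIndex j) with h | h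
  · exact hcase i j h
  · rw [lip_comm, hcase j i h]
    exact congrFun (congrFun lorentzMatrix_transpose i) j

end AdaptedFrames

/-! ### Existence of frames of order k + 1 where F₀, …, F_{k+1} are independent. -/

section ExistenceOfFrames

open Matrix

variable {n : ℕ} {I V : Set ℝ} {t q : ℝ} {f : ℝ → ProjSpace n} {F N : ℕ → ℝ → Coord n}
  {r y : ℝ → ℝ}

lemma contDiffOn_adaptedColumn (hn : 1 ≤ n) (hF : IsNormalLift I f F)
    (hN : ∀ m < n - 1, ContDiffOn ℝ ∞ (N m) (I ∩ V)) (hr : ContDiffOn ℝ ∞ r (I ∩ V))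
    (hr0 : ∀ t ∈ I ∩ V, r t ≠ 0) (hy : ContDiffOn ℝ ∞ y (I ∩ V)) (b : Fin (n + 2)) :
    ContDiffOn ℝ ∞ (adaptedColumn F N r y b) (I ∩ V) := by
  have hF' : ∀ i, ContDiffOn ℝ ∞ (F i) (I ∩ V) := fun i =>
    (hF.smooth i).mono Set.inter_subset_left
  rcases flagIndex_cases hn b with ⟨-, h⟩ | ⟨-, h⟩ | ⟨-, h⟩ | ⟨-, h, h'⟩
  · subst h
    exact (hr.smul (hF' 0)).congr fun t _ => adaptedColumn_zero
  · exact ((hF' 1).add (hy.smul (hF' 0))).congr fun t _ => adaptedColumn_one hn h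
  · subst h
    exact ((hr.inv hr0).smul (((hF' 2).add (hy.smul (hF' 1))).add
      (((((hF' 2).lip (hF' 2)).add (hy.mul hy)).div_const 2).smul (hF' 0)))).congr
        fun t _ => adaptedColumn_last
  · exact (hN _ (by omega)).congr fun t _ => adaptedColumn_normal h h'

/-- Smoothness, on the part of `I` in an open set, of the derivative along `I`. -/
lemma contDiffOn_derivWithin_inter (hI : UniqueDiffOn ℝ I) (hV : IsOpen V)
    (hr : ContDiffOn ℝ ∞ r (I ∩ V)) : ContDiffOn ℝ ∞ (derivWithin r I) (I ∩ V) :=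
  (hr.derivWithin (hI.inter hV) (m := ∞) (by simp)).congr fun _ ht =>
    (derivWithin_inter (hV.mem_nhds ht.2)).symm

/-- The frame built from the normal lift and normal vectors orthogonal to its derivatives. -/
lemma isFrame_oriented_adaptedMatrix (hn : 3 ≤ n) (hI : UniqueDiffOn ℝ I) (hV : IsOpen V)
    (hF : IsNormalLift I f F) {k : ℕ} (hk : 1 ≤ k)
    (hN : ∀ m < n - 1, ContDiffOn ℝ ∞ (N m) (I ∩ V)) (hr : ContDiffOn ℝ ∞ r (I ∩ V))
    (hr0 : ∀ t ∈ I ∩ V, 0 < r t) (hy : ∀ t ∈ I ∩ V, y t = derivWithin r I t / r t)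
    (hFN : ∀ t ∈ I ∩ V, ∀ m < n - 1, ∀ j < k + 2, j < m + 3 → lip n (F j t) (N m t) = 0)
    (hNN : ∀ t ∈ I ∩ V, ∀ m < n - 1, ∀ l < n - 1,
      lip n (N m t) (N l t) = if m = l then 1 else 0)
    (hrN : 2 ≤ k → ∀ t ∈ I ∩ V, lip n (F 3 t) (N 0 t) = r t * r t)
    (hind : ∀ t ∈ I ∩ V, JetIndependent F (k + 1) t) :
    IsFrame I f (k + 1) (I ∩ V) fun t => oriented (adaptedMatrix F N r y t) := by
  have hn1 : 1 ≤ n := by omega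
  have hys : ContDiffOn ℝ ∞ y (I ∩ V) :=
    ((contDiffOn_derivWithin_inter hI hV hr).div hr fun t ht => (hr0 t ht).ne').congr hy
  have hA : ∀ i b, ContDiffOn ℝ ∞ (fun t => adaptedMatrix F N r y t i b) (I ∩ V) := fun i b =>
    contDiffOn_pi.1 (contDiffOn_adaptedColumn hn1 hF hN hr (fun t ht => (hr0 t ht).ne') hys b) i
  have hL : ∀ t ∈ I ∩ V, (adaptedMatrix F N r y t)ᵀ * lorentzMatrix n * adaptedMatrix F N r y t
      = lorentzMatrix n := fun t ht => adaptedMatrix_lorentz hn1 hI hF ht.1 (hr0 t ht).ne'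
    (fun m hm j hj => hFN t ht m hm j (by omega) (by omega)) (hNN t ht)
  set e : ℝ → Matrix (Fin (n + 2)) (Fin (n + 2)) ℝ :=
    fun t => oriented (adaptedMatrix F N r y t) with he_def
  have he : IsLorentzFrame I V e := by
    refine ⟨hV, fun i j => ?_, fun t ht => oriented_lorentz hn1 (hL t ht)⟩
    simp only [he_def, oriented_apply, orientationFactor]
    split_ifs
    · exact (hA i j).mul (contDiffOn_det hA)
    · exact (hA i j).mul contDiffOn_const
  have hcol : ∀ t, ∀ b : Fin (n + 2), b.val ≠ n → (e t).col b = adaptedColumn F N r y b t :=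
    fun t b hb => oriented_col_of_ne _ hb
  have hcol0 : ∀ t, (e t).col 0 = r t • F 0 t := fun t => by
    rw [hcol t 0 (by simp; omega), adaptedColumn_zero]
  have hcol1 : ∀ t, (e t).col ⟨1, by omega⟩ = F 1 t + y t • F 0 t := fun t => by
    rw [hcol t _ (by simp; omega), adaptedColumn_one hn1 rfl]
  have hcoll : ∀ t, (e t).col (Fin.last (n + 1)) = (r t)⁻¹ • (F 2 t + y t • F 1 t
      + ((lip n (F 2 t) (F 2 t) + y t * y t) / 2) • F 0 t) := fun t => by
    rw [hcol t _ (by simp), adaptedColumn_last]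
  have f0 : IsFrame I f 0 (I ∩ V) e := by
    refine ⟨he.smooth, fun t ht => ?_⟩
    have hc : (fun i => e t i 0) = r t • F 0 t := hcol0 t
    have hcone : (fun i => e t i 0) ∈ positiveCone n := by
      obtain ⟨h1, h2⟩ := mem_positiveCone.1 (hF.mem_cone t ht.1)
      rw [hc, mem_positiveCone]
      simp only [map_smul, LinearMap.smul_apply, h1, smul_eq_mul, mul_zero, true_and]
      exact mul_pos (hr0 t ht) h2
    refine ⟨⟨he.lorentz t ht, oriented_det (hL t ht), fun v hv =>
      mulVec_mem_positiveCone (he.lorentz t ht) hcone hv⟩, ?_⟩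
    rw [hc]
    exact (represents_iff_of_represents (hF.represents t ht.1)).2 ⟨_, (hr0 t ht).ne', rfl⟩
  have hmem : ∀ j ≤ k + 1, ∀ t ∈ I ∩ V, (e t)⁻¹ *ᵥ F j t ∈ flagSpace n j := by
    intro j hj t ht c hc
    rw [inv_mulVec_apply (he.lorentz t ht), mul_eq_zero]
    right
    rcases flagIndex_cases hn1 c with ⟨h1, h2⟩ | ⟨h1, h2⟩ | ⟨h1, h2⟩ | ⟨h1, h2, h3⟩
    · omega
    · obtain rfl : j = 0 := by omega
      have hc1 : c = ⟨1, by omega⟩ := Fin.ext h2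
      rw [hc1, flipIdx_of_ne (by simp) (by simp [Fin.ext_iff]; omega), hcol1]
      simp [hF.lip_zero_zero ht.1, lip_comm (F 1 t), hF.lip_zero_one hI ht.1]
    · subst h2
      rw [flipIdx_last, hcol0]
      obtain rfl | rfl : j = 0 ∨ j = 1 := by omega
      · simp [hF.lip_zero_zero ht.1]
      · simp [hF.lip_zero_one hI ht.1]
    · rw [flipIdx_of_ne (by rintro rfl; simp at h2) (by rintro rfl; simp at h3), oriented_col,
        adaptedMatrix_col, adaptedColumn_normal h2 h3, map_smul, LinearMap.smul_apply, lip_comm,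
        hFN t ht _ (by omega) j (by omega) (by omega), smul_zero]
  refine isFrame_of_isHessenberg hn1 hk hI hV f0 (fun t ht =>
    isHessenberg_of_mem_flagSpace hn1 he hI hF hmem hind ht) fun hk2 t ht => ?_
  have hlt1 : 1 < n + 2 := by omega
  have hlt2 : 2 < n + 2 := by omega
  have hrd := hasDerivWithinAt_of_contDiffOn_inter hV hr ht
  -- The choice y = r'/r gives (r F₀)' = r (F₁ + y F₀), that is e₀' = r e₁. Hence φ^1_0 = r and
  -- φ^0_0 = 0.
  have hd0 : colDeriv I e t 0 = r t • (e t).col ⟨1, hlt1⟩ := by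
    have h1 := he.hasDerivWithinAt_col ht 0
    simp only [hcol0] at h1
    rw [(hI t ht.1).eq_deriv _ h1 (hrd.smul (hF.deriv 0 t ht.1)), hcol1, hy t ht, smul_add,
      smul_smul, mul_div_cancel₀ _ (hr0 t ht).ne']
  have h10 : mcForm I e t 1 0 = r t := by
    rw [mcForm_of_lt I e t hlt1 (by omega), he.maurerCartan_apply ht,
      flipIdx_of_ne (by simp) (by simp [Fin.ext_iff]; omega),
      flipSign_of_ne (by simp) (by simp [Fin.ext_iff]; omega)]
    change 1 * lip n ((e t).col ⟨1, hlt1⟩) (colDeriv I e t 0) = r t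
    rw [hd0, map_smul, lorentz_iff_lip_col.1 (he.lorentz t ht), lorentzMatrix_apply,
      flipIdx_of_ne (by simp) (by simp [Fin.ext_iff]; omega),
      flipSign_of_ne (by simp) (by simp [Fin.ext_iff]; omega)]
    simp
  have h00 : mcForm I e t 0 0 = 0 := by
    rw [mcForm_of_lt I e t (by omega) (by omega), he.maurerCartan_apply ht]
    change flipSign 0 * lip n ((e t).col (flipIdx 0)) (colDeriv I e t 0) = 0
    rw [hd0, flipIdx_zero, map_smul, lorentz_iff_lip_col.1 (he.lorentz t ht), lorentzMatrix_apply,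
      flipIdx_last, if_neg (by simp)]
    simp
  refine ⟨?_, h00⟩
  have hw : ContDiffOn ℝ ∞ (fun t => (lip n (F 2 t) (F 2 t) + y t * y t) / 2) (I ∩ V) := by
    have := (hF.smooth 2).mono (Set.inter_subset_left (t := V))
    exact ((this.lip this).add (hys.mul hys)).div_const 2
  have hdl := he.hasDerivWithinAt_col ht (Fin.last (n + 1))
  simp only [hcoll] at hdl
  have hrid := hasDerivWithinAt_of_contDiffOn_inter hV (hr.inv fun t ht => (hr0 t ht).ne') ht
  have hyd := hasDerivWithinAt_of_contDiffOn_inter hV hys ht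
  have hwd := hasDerivWithinAt_of_contDiffOn_inter hV hw ht
  have hd := hrid.smul (((hF.deriv 2 t ht.1).add (hyd.smul (hF.deriv 1 t ht.1))).add
    (hwd.smul (hF.deriv 0 t ht.1)))
  have hdl' := (hI t ht.1).eq_deriv _ hdl hd
  -- As n ≥ 3, the sign change in column n leaves column 2 alone.
  have h2 : (e t).col ⟨2, hlt2⟩ = N 0 t := by
    rw [hcol t _ (by simp; omega), adaptedColumn_normal le_rfl (by simp; omega)]
    rfl
  have n0 := hFN t ht 0 (by omega) 0 (by omega) (by omega)
  have n1 := hFN t ht 0 (by omega) 1 (by omega) (by omega)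
  have n2 := hFN t ht 0 (by omega) 2 (by omega) (by omega)
  have n3 := hrN hk2 t ht
  rw [lip_comm] at n0 n1 n2 n3
  have hb0 : (⟨2, hlt2⟩ : Fin (n + 2)) ≠ 0 := by simp [Fin.ext_iff]
  have hb1 : (⟨2, hlt2⟩ : Fin (n + 2)) ≠ Fin.last (n + 1) := by simp [Fin.ext_iff]; omega
  rw [h10, mcForm_of_lt I e t (by omega) hlt2]
  -- φ^0_2 = φ^2_{n+1} = ⟨N₀, eₙ₊₁'⟩. Since N₀ is orthogonal to F₀, F₁, F₂, only r⁻¹⟨N₀, F₃⟩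
  -- remains, and r² = ⟨F₃, N₀⟩ makes it equal to r.
  refine (he.maurerCartan_apply_last hI ht hb0 hb1).symm.trans ?_
  rw [he.maurerCartan_apply ht, flipIdx_of_ne hb0 hb1, flipSign_of_ne hb0 hb1, h2, hdl']
  simp only [map_add, map_smul, Pi.smul_apply', smul_eq_mul, Pi.add_apply, zero_add,
    Nat.reduceAdd, n0, n1, n2, n3]
  have := (hr0 t ht).ne'
  simp
  field_simp

/-- Frames of order `k + 1` exist around every point at which the osculating space has the maximal
dimension. -/
lemma exists_isFrameNear (hn : 3 ≤ n) (hI : UniqueDiffOn ℝ I) (hF : IsNormalLift I f F)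
    (hq : q ∈ I) {k : ℕ} (hk : 1 ≤ k) (hkn : k ≤ n - 1) (hind : JetIndependent F (k + 2) q) :
    ∃ e, IsFrameNear I f (k + 1) q e := by
  -- Completing the k + 2 derivatives by constant vectors lets a single Gram-Schmidt process produce
  -- all n - 1 normal vectors, smoothly near q.
  obtain ⟨c, hc⟩ := exists_jetIndependent_extension hind (M := n + 2) (by omega) le_rfl
  set Z : ℕ → ℝ → Coord n := fun i t => if i < k + 2 then F i t else c i with hZdef
  have hZF : ∀ i < k + 2, Z i = F i := fun i hi => by ext1 t; simp [Z, hi]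
  have hZ : ∀ i, ContDiffOn ℝ ∞ (Z i) I := fun i => by
    by_cases hi : i < k + 2
    · rw [hZF i hi]; exact hF.smooth i
    · simp only [Z, if_neg hi]; exact contDiffOn_const
  obtain ⟨V, hV, hqV, hVind⟩ := exists_isOpen_jetIndependent hZ hq hc
  have hZV : ∀ i, ContDiffOn ℝ ∞ (Z i) (I ∩ V) := fun i => (hZ i).mono Set.inter_subset_left
  have hFV : ∀ i, ContDiffOn ℝ ∞ (F i) (I ∩ V) := fun i =>
    (hF.smooth i).mono Set.inter_subset_left
  let u : Fin 3 → ℝ → Coord n :=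
    ![F 0, F 1, fun t => F 2 t + (lip n (F 2 t) (F 2 t) / 2) • F 0 t]
  have hu : IsNullTriad u (I ∩ V) := by
    constructor
    · intro i
      fin_cases i
      · exact hFV 0
      · exact hFV 1
      · exact (hFV 2).add ((((hFV 2).lip (hFV 2)).div_const 2).smul (hFV 0))
    · exact fun t ht => hF.mem_cone t ht.1
    · exact fun t ht => hF.lip_zero_one hI ht.1
    · intro t ht
      simp [u, hF.lip_zero_two hI ht.1, hF.lip_zero_zero ht.1]
    · exact fun t ht => hF.unit t ht.1
    · intro t ht
      simp [u, hF.lip_one_two hI ht.1, lip_comm (F 1 t) (F 0 t), hF.lip_zero_one hI ht.1]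
    · intro t ht
      simp [u, hF.lip_zero_two hI ht.1, lip_comm (F 2 t) (F 0 t), hF.lip_zero_zero ht.1]
      ring
  have huZ : ∀ t ∈ I ∩ V, ∀ i, u i t ∈ jetSpan Z 3 t := by
    intro t _ i
    have h : ∀ j < 3, F j t ∈ jetSpan Z 3 t := fun j hj => by
      rw [← hZF j (by omega)]; exact mem_jetSpan hj
    fin_cases i
    · exact h 0 (by omega)
    · exact h 1 (by omega)
    · exact Submodule.add_mem _ (h 2 (by omega)) (Submodule.smul_mem _ _ (h 0 (by omega)))
  have hZu : ∀ t ∈ I ∩ V, ∀ i < 3, ∀ W : Submodule ℝ (Coord n), (∀ j, u j t ∈ W) → Z i t ∈ W := by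
    intro t _ i hi W hW
    rw [hZF i (by omega)]
    have h0 : F 0 t ∈ W := hW 0
    have h1 : F 1 t ∈ W := hW 1
    have h2 : F 2 t + (lip n (F 2 t) (F 2 t) / 2) • F 0 t ∈ W := hW 2
    interval_cases i
    · exact h0
    · exact h1
    · exact (W.add_mem_iff_left (W.smul_mem _ h0)).1 h2
  have hMind : ∀ t ∈ I ∩ V, JetIndependent Z (n - 1 + 3) t := fun t ht => by
    have : n - 1 + 3 = n + 2 := by omega
    rw [this]; exact hVind t ht
  have hspec := hu.gramSchmidt_spec hZV huZ hMind
  set N := triadGramSchmidt u Z with hNdef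
  have hpos : ∀ t ∈ I ∩ V, 0 < lip n (Z 3 t) (N 0 t) := fun t ht => by
    obtain ⟨-, h2, h3⟩ := hu.lip_gramSchmidt_self_pos hZV huZ hMind ht (show 0 < n - 1 by omega)
    rw [zero_add] at h2
    rw [h2]; exact h3
  -- For k ≥ 2 one has Z₃ = F₃, and this is the scale required by φ^0_2 = φ^1_0. For k = 1 the
  -- vector Z₃ is one of the added constants, and any positive smooth scale would do.
  let r : ℝ → ℝ := fun t => √(lip n (Z 3 t) (N 0 t))
  refine ⟨_, V, hV, hqV, isFrame_oriented_adaptedMatrix (N := N) (r := r)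
    (y := fun t => derivWithin r I t / r t) hn hI hV hF hk (fun m hm => (hspec m hm).1)
    (((hZV 3).lip (hspec 0 (by omega)).1).sqrt fun t ht => (hpos t ht).ne')
    (fun t ht => Real.sqrt_pos.2 (hpos t ht)) (fun t _ => rfl) ?_ ?_ ?_ ?_⟩
  · intro t ht m hm j hj hjm
    rw [← hZF j hj]
    exact hu.lip_gramSchmidt_eq_zero hZV huZ hZu hMind ht hm hjm
  · intro t ht m hm l hl
    rcases lt_trichotomy m l with h | h | h
    · rw [if_neg h.ne]; exact ((hspec l hl).2 t ht).2.2.1 m h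
    · subst h; rw [if_pos rfl]; exact ((hspec m hm).2 t ht).2.2.2.1
    · rw [if_neg h.ne', lip_comm]; exact ((hspec m hm).2 t ht).2.2.1 l h
  · intro hk2 t ht
    rw [← hZF 3 (by omega)]
    exact (Real.mul_self_sqrt (hpos t ht).le).symm
  · intro t ht
    have h1 : JetIndependent Z (k + 1) t := (hVind t ht).of_le (by omega)
    unfold JetIndependent at h1 ⊢
    convert h1 using 2 with i
    rw [hZF i (by omega)]

end ExistenceOfFrames

/-! ### Conformal spheres as osculating subspaces, and the characterization of degeneracy. -/

section OsculatingSpheres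

open Matrix

variable {n : ℕ} {I V : Set ℝ} {t q : ℝ} {f : ℝ → ProjSpace n} {F : ℕ → ℝ → Coord n}

/-- At a `k`-generic point the first `k + 3` derivatives of the lift are independent. -/
lemma jetIndependent_of_isGenericAt (hn : 3 ≤ n) (hI : UniqueDiffOn ℝ I)
    (hF : IsNormalLift I f F) (hq : q ∈ I) {k : ℕ} (hk : k ≤ n) (h : IsGenericAt I f k q) :
    JetIndependent F (k + 3) q := by
  induction k with
  | zero => exact hF.jetIndependent_three hI hq
  | succ k ih =>
    obtain ⟨h1, e, ⟨V, hV, hqV, he⟩, hinv⟩ := h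
    have h2 := ih (by omega) h1
    by_contra hcon
    exact hinv ((invariantVanishes_iff_not_jetIndependent (by omega) hI hV hF (by omega) hk he
      ⟨hq, hqV⟩ h2).2 hcon)

/-- A conformal sphere is the part of the conformal space in the span of vectors of a frame. -/
lemma isConformalSphere_frameSpan_iff {k : ℕ} (hk : 1 ≤ k)
    {G : Matrix (Fin (n + 2)) (Fin (n + 2)) ℝ} (hG : G ∈ moebius n) {v : Coord n}
    {x : ProjSpace n} (hx : x ∈ conformalSpace n)
    (hv : Represents v x) :
    (∃ w : Coord n, ∃ y ∈ standardSphere n k, Represents w y ∧ Represents (G *ᵥ w) x) ↔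
      v ∈ frameSpan G (k + 1) := by
  have hstd : ∀ y : ProjSpace n, y ∈ standardSphere n k ↔
      y ∈ conformalSpace n ∧ y.rep ∈ flagSpace n (k + 1) := by
    intro y
    refine and_congr_right fun _ => forall_congr' fun b => ?_
    rw [flagIndex_gt_iff hk, and_imp]
  rw [mem_frameSpan hG.1]
  constructor
  · rintro ⟨w, y, hy, hwy, hwx⟩
    obtain ⟨a, -, ha⟩ := (represents_iff_of_represents hwx).1 hv
    obtain ⟨b, -, hb⟩ := (represents_iff_of_represents (represents_rep y)).1 hwy
    rw [ha, mulVec_smul, mulVec_mulVec, inv_mul_of_lorentz hG.1, one_mulVec, hb]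
    exact Submodule.smul_mem _ _ (Submodule.smul_mem _ _ ((hstd y).1 hy).2)
  · intro h
    set w := G⁻¹ *ᵥ v with hw
    have hGw : G *ᵥ w = v := by rw [hw, mulVec_mulVec, mul_inv_of_lorentz hG.1, one_mulVec]
    have hw0 : w ≠ 0 := fun h0 => hv.1 (by rw [← hGw, h0, mulVec_zero])
    have hwr : Represents w (Projectivization.mk ℝ w hw0) := ⟨hw0, rfl⟩
    refine ⟨w, _, (hstd _).2 ⟨?_, ?_⟩, hwr, by rwa [hGw]⟩
    · obtain ⟨a, -, ha⟩ := (represents_iff_of_represents hwr).1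
        (represents_rep (Projectivization.mk ℝ w hw0))
      change lorentzForm _ = 0
      rw [lorentzForm_eq, ha, map_smul, map_smul, LinearMap.smul_apply, ← lip_mulVec hG.1, hGw,
        hv.lip_self_eq_zero hx, smul_zero, smul_zero]
    · obtain ⟨a, -, ha⟩ := (represents_iff_of_represents hwr).1
        (represents_rep (Projectivization.mk ℝ w hw0))
      rw [ha]
      exact Submodule.smul_mem _ _ h

/-- A curve lies in a conformal `k`-sphere if and only if its lift lies in a span of frame
vectors. -/
lemma exists_isConformalSphere_iff (hf : ∀ t ∈ I, f t ∈ conformalSpace n)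
    (hF : IsNormalLift I f F) {k : ℕ} (hk : 1 ≤ k) :
    (∃ Q : Set (ProjSpace n), IsConformalSphere n k Q ∧ ∀ t ∈ I, f t ∈ Q) ↔
      ∃ G ∈ moebius n, ∀ t ∈ I, F 0 t ∈ frameSpan G (k + 1) := by
  constructor
  · rintro ⟨Q, ⟨G, hG, rfl⟩, hQ⟩
    exact ⟨G, hG, fun t ht =>
      (isConformalSphere_frameSpan_iff hk hG (hf t ht) (hF.represents t ht)).1 (hQ t ht)⟩
  · rintro ⟨G, hG, h⟩
    exact ⟨_, ⟨G, hG, rfl⟩, fun t ht =>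
      (isConformalSphere_frameSpan_iff hk hG (hf t ht) (hF.represents t ht)).2 (h t ht)⟩

/-- The derivatives of a curve in a span of frame vectors stay in it. -/
lemma mem_frameSpan_of_lift_mem (hI : UniqueDiffOn ℝ I) (hF : IsNormalLift I f F)
    {G : Matrix (Fin (n + 2)) (Fin (n + 2)) ℝ}
    (hG : Gᵀ * lorentzMatrix n * G = lorentzMatrix n) {m : ℕ}
    (h : ∀ t ∈ I, F 0 t ∈ frameSpan G m) (i : ℕ) : ∀ t ∈ I, F i t ∈ frameSpan G m := by
  induction i with
  | zero => exact h
  | succ i ih =>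
    intro t ht
    rw [mem_frameSpan hG]
    intro c hc
    -- Membership in the fixed span is the vanishing of products with fixed columns of `G`, a
    -- condition that can be differentiated.
    have h1 := lip_deriv_of_eq_const hI ht (hasDerivWithinAt_const t I (G.col (flipIdx c)))
      (hF.deriv i t ht) (a := 0) fun s hs => by
        have h2 := (mem_frameSpan hG).1 (ih s hs) c hc
        rw [inv_mulVec_apply hG] at h2
        exact (mul_eq_zero.1 h2).resolve_left (flipSign_ne_zero _)
    rw [map_zero, LinearMap.zero_apply, zero_add] at h1
    rw [inv_mulVec_apply hG, h1, mul_zero]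

/-- If the osculating spaces stop growing on an interval, then they are constant near every point
at which there is a frame of the corresponding order. -/
lemma jetSpan_eq_of_not_jetIndependent (hn : 3 ≤ n) (hI : UniqueDiffOn ℝ I)
    (hF : IsNormalLift I f F) {k : ℕ} (hk : 1 ≤ k)
    {e : ℝ → Matrix (Fin (n + 2)) (Fin (n + 2)) ℝ} (hV : IsOpen V)
    (hconv : Convex ℝ (I ∩ V)) (he : IsFrame I f (k + 1) (I ∩ V) e)
    (hind : ∀ t ∈ I ∩ V, JetIndependent F (k + 2) t)
    (hdep : ∀ t ∈ I ∩ V, ¬ JetIndependent F (k + 3) t) :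
    (∀ t ∈ I ∩ V, jetSpan F (k + 2) t = frameSpan (e t) (k + 1)) ∧
      ∀ s ∈ I ∩ V, ∀ t ∈ I ∩ V, jetSpan F (k + 2) s = jetSpan F (k + 2) t := by
  have hn1 : 1 ≤ n := by omega
  have heL := isLorentzFrame_of_isFrame hV he
  have h0 : ∀ t ∈ I ∩ V, (e t)⁻¹ *ᵥ F 0 t ∈ flagSpace n 0 := fun t ht =>
    lift_mem_flagSpace_zero hF hV he ht
  have hH : ∀ t ∈ I ∩ V, IsHessenberg k (maurerCartan I e t) := fun t ht =>
    isHessenberg_of_isFrame hn1 hk hI hV he ht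
  have hblock : ∀ t ∈ I ∩ V, ∀ b c, flagIndex b ≤ k + 1 → k + 1 < flagIndex c →
      maurerCartan I e t c b = 0 := by
    intro t ht b c hb hc
    rcases Nat.lt_or_ge (flagIndex b) (k + 1) with h1 | h1
    · exact hH t ht b c (by omega) (by omega)
    · exact (not_jetIndependent_iff hn1 heL hI hF h0 hH ht (hind t ht)
        (le_antisymm hb h1)).2 (hdep t ht) c hc
  have hspan : ∀ t ∈ I ∩ V, jetSpan F (k + 2) t = frameSpan (e t) (k + 1) := fun t ht =>
    jetSpan_eq_frameSpan hn1 (hind t ht) fun i hi => by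
      rw [mem_frameSpan (heL.lorentz t ht)]
      exact flagSpace_mono (by omega) (lift_mem_flagSpace heL hI hF h0 hH i (by omega) t ht)
  refine ⟨hspan, fun s hs t ht => ?_⟩
  rw [hspan s hs, hspan t ht]
  exact le_antisymm (frameSpan_le_of_block heL hI hconv (by omega) hblock hs ht)
    (frameSpan_le_of_block heL hI hconv (by omega) hblock ht hs)

/-- The characterization of totally degenerate curves by their osculating spaces. -/
lemma isTotallyDegenerate_iff (hn : 3 ≤ n) (hI : I.OrdConnected) (hI' : I.Nontrivial)
    (hf : IsImmersedCurve I f) {k : ℕ} (hk : 1 ≤ k) (hkn : k ≤ n - 1)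
    (hgen : IsGeneric I f (k - 1)) :
    IsTotallyDegenerate I f k ↔
      ∃ Q : Set (ProjSpace n), IsConformalSphere n k Q ∧ ∀ t ∈ I, f t ∈ Q := by
  have hU := uniqueDiffOn_of_ordConnected hI hI'
  obtain ⟨F, hF⟩ := exists_isNormalLift hU hf
  have hind : ∀ t ∈ I, JetIndependent F (k + 2) t := fun t ht => by
    have := jetIndependent_of_isGenericAt hn hU hF ht (by omega) (hgen t ht)
    rwa [show k - 1 + 3 = k + 2 by omega] at this
  rw [exists_isConformalSphere_iff hf.1 hF hk]
  constructor
  · rintro ⟨-, hdeg⟩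
    -- Degeneracy provides, for each point, a frame whose invariant vanishes at that point only.
    -- Dependence of the derivatives does not refer to a frame, so it holds at all points and can be
    -- used in any one frame on a whole neighbourhood.
    have hdep : ∀ t ∈ I, ¬ JetIndependent F (k + 3) t := by
      intro t ht
      obtain ⟨e, ⟨V, hV, htV, he⟩, hinv⟩ := hdeg t ht
      exact (invariantVanishes_iff_not_jetIndependent (by omega) hU hV hF hk (by omega) he
        ⟨ht, htV⟩ (hind t ht)).1 hinv
    have hloc : ∀ q ∈ I, ∃ G ∈ moebius n, ∃ ε > 0, jetSpan F (k + 2) q = frameSpan G (k + 1) ∧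
        ∀ t ∈ I ∩ Metric.ball q ε, jetSpan F (k + 2) q = jetSpan F (k + 2) t := by
      intro q hq
      obtain ⟨e, ⟨V, hV, hqV, he⟩, -⟩ := hdeg q hq
      obtain ⟨ε, hε, hsub⟩ := Metric.isOpen_iff.1 hV q hqV
      -- Shrinking to a ball makes the domain an interval, as the constancy of the projection
      -- requires.
      have hsub' : I ∩ Metric.ball q ε ⊆ I ∩ V := Set.inter_subset_inter_right _ hsub
      have he' : IsFrame I f (k + 1) (I ∩ Metric.ball q ε) e := isFrame_mono hsub' _ he
      have hqb : q ∈ I ∩ Metric.ball q ε := ⟨hq, Metric.mem_ball_self hε⟩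
      obtain ⟨h1, h2⟩ := jetSpan_eq_of_not_jetIndependent hn hU hF hk Metric.isOpen_ball
        (hI.convex.inter (convex_ball q ε)) he' (fun t ht => hind t ht.1) (fun t ht => hdep t ht.1)
      exact ⟨e q, ((isFrame_of_le (Nat.zero_le _) he).2 q ⟨hq, hqV⟩).1, ε, hε, h1 q hqb,
        fun t ht => h2 q hqb t ht⟩
    obtain ⟨q, hq⟩ := hI'.nonempty
    obtain ⟨G, hG, -, -, hqG, -⟩ := hloc q hq
    refine ⟨G, hG, fun t ht => ?_⟩
    have hconst : jetSpan F (k + 2) q = jetSpan F (k + 2) t := by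
      -- Equality of osculating spaces is an equivalence relation that holds locally, hence on the
      -- connected set `I`.
      refine hI.isPreconnected.induction₂ (fun x y => jetSpan F (k + 2) x = jetSpan F (k + 2) y)
        (fun x hx => ?_) (fun _ _ _ _ _ _ h1 h2 => h1.trans h2) (fun _ _ _ _ h => h.symm) hq ht
      obtain ⟨-, -, ε, hε, -, h⟩ := hloc x hx
      filter_upwards [inter_mem_nhdsWithin I (Metric.ball_mem_nhds x hε)] with y hy
      exact h y hy
    rw [← hqG, hconst]
    exact mem_jetSpan (by omega)
  · rintro ⟨G, hG, h⟩
    refine ⟨hgen, fun q hq => ?_⟩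
    obtain ⟨e, V, hV, hqV, he⟩ := exists_isFrameNear hn hU hF hq hk hkn (hind q hq)
    refine ⟨e, ⟨V, hV, hqV, he⟩, (invariantVanishes_iff_not_jetIndependent (by omega) hU hV hF hk
      (by omega) he ⟨hq, hqV⟩ (hind q hq)).2 fun hcon => ?_⟩
    -- Independence would place k + 3 independent vectors in a space of dimension at most k + 2.
    have := hcon.le_of_mem (finrank_frameSpan_le (by omega) G (k + 1)) fun i _ =>
      mem_frameSpan_of_lift_mem hU hF hG.1 h i q hq
    omega

end OsculatingSpheres

theorem mainTheorem9 (n : ℕ) (hn : 3 ≤ n) (I : Set ℝ) (hI : I.OrdConnected)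
    (hI' : I.Nontrivial) (f : ℝ → ProjSpace n) (hf : IsImmersedCurve I f) :
    (IsTotallyDegenerate I f 1 ↔
      ∃ Q : Set (ProjSpace n), IsConformalSphere n 1 Q ∧ ∀ t ∈ I, f t ∈ Q) ∧
    ∀ k : ℕ, 2 ≤ k → k ≤ n - 1 → IsGeneric I f (k - 1) →
      (IsTotallyDegenerate I f k ↔
        ∃ Q : Set (ProjSpace n), IsConformalSphere n k Q ∧ ∀ t ∈ I, f t ∈ Q) :=
  ⟨isTotallyDegenerate_iff hn hI hI' hf le_rfl (by omega) fun _ _ => trivial,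
    fun _ hk hkn hgen => isTotallyDegenerate_iff hn hI hI' hf (by omega) hkn hgen⟩
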